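/- Let $M_k$ denote the set of complex $k\times k$ matrices, let $\Im(A)$ denote the image (range) of a matrix $A$, and let $T:M_k\to M_m$ be a positive map, i.e. a $\mathbb{C}$-linear map that sends positive semidefinite Hermitian matrices to positive semidefinite Hermitian matrices. Let $T^*:M_m\to M_k$ be the adjoint of $T$ with respect to the trace inner product $\langle A,B\rangle=\operatorname{tr}(AB^*)$, and suppose that $T(\mathrm{Id})$ and $T^*(\mathrm{Id})$ are positive definite Hermitian matrices. A positive map $S:M_k\to M_m$ is called doubly stochastic if $S\left(\frac{\mathrm{Id}}{\sqrt{k}}\right)=\frac{\mathrm{Id}}{\sqrt{m}}$ and $S^*\left(\frac{\mathrm{Id}}{\sqrt{m}}\right)=\frac{\mathrm{Id}}{\sqrt{k}}$. We say that $T$ is equivalent to $S$ if there are invertible matrices $X'\in M_k$ and $Y'\in M_m$ such that $S(X)=Y'\,T(X'XX'^*)\,Y'^*$ for every $X\in M_k$. For an orthogonal projection $V\in M_k$ write $VM_kV=\{VXV : X\in M_k\}$. Then $T$ is equivalent to a doubly stochastic map if and only if there are a number $s$ and non-zero orthogonal projections $V_1,\dots,V_s\in M_k$ and orthogonal projections $W_1,\dots,W_s\in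 M_m$ such that 1. $\mathbb{C}^k=\bigoplus_{i=1}^s\Im(V_i)$ and $\mathbb{C}^m=\bigoplus_{i=1}^s\Im(W_i)$ (direct sums of subspaces, not necessarily orthogonal); 2. $T(V_iM_kV_i)\subset W_iM_mW_i$ for every $i$; 3. for every $i$ and every positive semidefinite Hermitian $X\in V_iM_kV_i$ with $0<\operatorname{rank}(X)<\operatorname{rank}(V_i)$, $$\operatorname{rank}(X)\operatorname{rank}(W_i)<\operatorname{rank}(T(X))\operatorname{rank}(V_i);$$ 4. $\dfrac{\operatorname{rank}(W_i)}{\operatorname{rank}(V_i)}=\dfrac{m}{k}$ for every $i$. -/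

import Mathlib

open Matrix
open scoped ComplexOrder

noncomputable section

namespace MatrixMap

/-- A linear map `T : M_k → M_m` is positive if it sends positive semidefinite Hermitian matrices
to positive semidefinite Hermitian matrices. -/
def IsPositive {k m : ℕ}
    (T : Matrix (Fin k) (Fin k) ℂ →ₗ[ℂ] Matrix (Fin m) (Fin m) ℂ) : Prop :=
  ∀ X : Matrix (Fin k) (Fin k) ℂ, X.PosSemidef → (T X).PosSemidef

/-- The adjoint of `T` with respect to the trace inner product `⟨A, B⟩ = tr (A * Bᴴ)`: the entry
`(i, j)` of `T* B` is `⟨T* B, E_ij⟩ = ⟨B, T E_ij⟩`. The two theorems below show that this is the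
unique map with `⟨T A, B⟩ = ⟨A, T* B⟩` for all `A` and `B`. -/
def adjoint {k m : ℕ}
    (T : Matrix (Fin k) (Fin k) ℂ →ₗ[ℂ] Matrix (Fin m) (Fin m) ℂ) :
    Matrix (Fin m) (Fin m) ℂ →ₗ[ℂ] Matrix (Fin k) (Fin k) ℂ where
  toFun B := Matrix.of fun i j => (B * (T (Matrix.single i j 1))ᴴ).trace
  map_add' B C := by
    ext i j
    simp [Matrix.add_mul]
  map_smul' c B := by
    ext i j
    simp

theorem trace_mul_adjoint {k m : ℕ}
    (T : Matrix (Fin k) (Fin k) ℂ →ₗ[ℂ] Matrix (Fin m) (Fin m) ℂ)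
    (A : Matrix (Fin k) (Fin k) ℂ) (B : Matrix (Fin m) (Fin m) ℂ) :
    (T A * Bᴴ).trace = (A * (adjoint T B)ᴴ).trace := by
  have h1 : ∀ i j, star ((B * (T (Matrix.single i j 1))ᴴ).trace)
      = (T (Matrix.single i j 1) * Bᴴ).trace := by
    intro i j
    rw [← Matrix.trace_conjTranspose, Matrix.conjTranspose_mul, Matrix.conjTranspose_conjTranspose]
  have h2 : (A * (adjoint T B)ᴴ).trace
      = ∑ i, ∑ j, A i j * (T (Matrix.single i j 1) * Bᴴ).trace := by
    simp only [Matrix.trace, Matrix.diag_apply, Matrix.mul_apply (M := A),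
      Matrix.conjTranspose_apply (adjoint T B)]
    refine Finset.sum_congr rfl fun i _ => Finset.sum_congr rfl fun j _ => ?_
    exact congrArg (A i j * ·) (h1 i j)
  rw [h2]
  conv_lhs => rw [Matrix.matrix_eq_sum_single A]
  simp only [map_sum, Matrix.sum_mul, Matrix.trace_sum]
  refine Finset.sum_congr rfl fun i _ => Finset.sum_congr rfl fun j _ => ?_
  have h3 : Matrix.single i j (A i j) = A i j • Matrix.single i j (1 : ℂ) := by simp
  rw [h3, map_smul, Matrix.smul_mul, Matrix.trace_smul, smul_eq_mul]

theorem adjoint_unique {k m : ℕ}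
    (T : Matrix (Fin k) (Fin k) ℂ →ₗ[ℂ] Matrix (Fin m) (Fin m) ℂ)
    (S : Matrix (Fin m) (Fin m) ℂ → Matrix (Fin k) (Fin k) ℂ)
    (hS : ∀ A B, (T A * Bᴴ).trace = (A * (S B)ᴴ).trace) :
    S = adjoint T := by
  funext B
  have h : (S B)ᴴ = (adjoint T B)ᴴ :=
    Matrix.ext_iff_trace_mul_left.2 fun A => by rw [← hS, trace_mul_adjoint]
  exact Matrix.conjTranspose_injective h

/-- A positive map `T : M_k → M_m` is doubly stochastic if `T (Id / √k) = Id / √m` and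
`T* (Id / √m) = Id / √k`. -/
def IsDoublyStochastic {k m : ℕ}
    (T : Matrix (Fin k) (Fin k) ℂ →ₗ[ℂ] Matrix (Fin m) (Fin m) ℂ) : Prop :=
  IsPositive T ∧
    T (((Real.sqrt k : ℝ) : ℂ)⁻¹ • 1) = ((Real.sqrt m : ℝ) : ℂ)⁻¹ • 1 ∧
    adjoint T (((Real.sqrt m : ℝ) : ℂ)⁻¹ • 1) = ((Real.sqrt k : ℝ) : ℂ)⁻¹ • 1

/-- `T₁` is equivalent to `T` if `T₁ X = Y' * T (X' * X * X'ᴴ) * Y'ᴴ` for some invertible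
`X' ∈ M_k` and `Y' ∈ M_m`. -/
def Equivalent {k m : ℕ}
    (T T₁ : Matrix (Fin k) (Fin k) ℂ →ₗ[ℂ] Matrix (Fin m) (Fin m) ℂ) : Prop :=
  ∃ (X' : Matrix (Fin k) (Fin k) ℂ) (Y' : Matrix (Fin m) (Fin m) ℂ),
    IsUnit X' ∧ IsUnit Y' ∧ ∀ X, T₁ X = Y' * T (X' * X * X'ᴴ) * Y'ᴴ

/-- The set `V M_k V = {V * X * V : X ∈ M_k}`. -/
def corner {k : ℕ} (V : Matrix (Fin k) (Fin k) ℂ) : Set (Matrix (Fin k) (Fin k) ℂ) :=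
  {Z | ∃ X : Matrix (Fin k) (Fin k) ℂ, Z = V * X * V}

/-- The image of a matrix, as a subspace of `ℂ^k`. -/
def image {k : ℕ} (V : Matrix (Fin k) (Fin k) ℂ) : Submodule ℂ (Fin k → ℂ) :=
  LinearMap.range V.mulVecLin

end MatrixMap

end

/-! Both directions rest on scaling points: positive definite `X` critical for `det(X)^m / det(T
X)^k`, that is, `k tr(T(X)⁻¹ T(H)) = m tr(X⁻¹ H)` for all `H`. If `X = C Cᴴ` and `T X = B Bᴴ`, then
`Z ↦ B⁻¹ T(C Z Cᴴ) B⁻ᴴ` is unital and the critical equation says that it multiplies traces by `m/k`,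
so a rescaling of it is doubly stochastic (`IsScalingPoint.exists_equivalent`).

From the decomposition to a doubly stochastic map: the strict rank inequality yields a scaling point
in each block (`exists_isScalingPoint`). The perturbation `T + ε tr(·) Id` has a maximizer of the
quotient by compactness. As `ε → 0` the maximizers converge; were the limit `X₀` singular, testing
the critical equations on the part of the maximizers that survives would give `k rank T(X₀) ≤ m rank
X₀`, against the hypothesis. The sum of the block scaling points is a scaling point of `T`:
off-diagonal blocks do not contribute, because a positive semidefinite form that vanishes on a
subspace has that subspace in its kernel.

Conversely, normalize the doubly stochastic map to a unital `R` with `tr R(Z) = (m/k) tr Z`. For a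
projection `P`, `0 ≤ R(P) ≤ 1` gives `(m/k) rank P = tr R(P) ≤ rank R(P)`, with equality exactly
when `R(P)` is a projection. Splitting the identity into minimal projections of this kind makes the
inequality strict inside each block; the invertible matrices of the equivalence then carry the
blocks over to `T`. -/

namespace Matrix

/-! ### Positive semidefinite matrices: order, rank and spectral calculus -/

section General

variable {n : Type*} [Fintype n]

theorem rank_le_rank_of_ker {A B : Matrix n n ℂ} (h : ∀ x, B *ᵥ x = 0 → A *ᵥ x = 0) :
    A.rank ≤ B.rank := by
  have hk : LinearMap.ker B.mulVecLin ≤ LinearMap.ker A.mulVecLin := fun x hx => h x hx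
  have h1 := LinearMap.finrank_range_add_finrank_ker A.mulVecLin
  have h2 := LinearMap.finrank_range_add_finrank_ker B.mulVecLin
  have h3 := Submodule.finrank_mono hk
  simp only [Matrix.rank]
  omega

/-- On `ker B` the form of `C B - A` is that of `-A`, so `xᴴ A x = 0`, and a semidefinite form
vanishes only on its kernel. -/
theorem PosSemidef.mulVec_eq_zero_of_smul_sub {A B : Matrix n n ℂ} (hA : A.PosSemidef) {C : ℂ}
    (h : (C • B - A).PosSemidef) {x : n → ℂ} (hx : B *ᵥ x = 0) : A *ᵥ x = 0 := by
  rw [← hA.dotProduct_mulVec_zero_iff]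
  refine le_antisymm ?_ (hA.dotProduct_mulVec_nonneg x)
  have := h.dotProduct_mulVec_nonneg x
  rw [sub_mulVec, smul_mulVec, hx] at this
  simpa using this

theorem PosSemidef.rank_le_of_smul_sub {A B : Matrix n n ℂ} (hA : A.PosSemidef) {C : ℂ}
    (h : (C • B - A).PosSemidef) : A.rank ≤ B.rank :=
  rank_le_rank_of_ker fun _ hx => hA.mulVec_eq_zero_of_smul_sub h hx

theorem PosSemidef.posDef_of_smul_sub {A B : Matrix n n ℂ} (hB : B.PosSemidef) (hA : A.PosDef)
    {C : ℂ} (h : (C • B - A).PosSemidef) : B.PosDef := by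
  rw [posDef_iff_dotProduct_mulVec]
  refine ⟨hB.1, fun {x} hx => lt_of_le_of_ne (hB.dotProduct_mulVec_nonneg x) fun h0 => ?_⟩
  have := hA.posSemidef.mulVec_eq_zero_of_smul_sub h ((hB.dotProduct_mulVec_zero_iff x).1 h0.symm)
  have h2 := hA.dotProduct_mulVec_pos hx
  simp [this] at h2

variable [DecidableEq n]

theorem IsHermitian.exists_unitary_diagonal {A : Matrix n n ℂ} (hA : A.IsHermitian) :
    ∃ U : Matrix n n ℂ, Uᴴ * U = 1 ∧ U * Uᴴ = 1 ∧ ∃ l : n → ℝ,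
      A = U * diagonal (fun i => (l i : ℂ)) * Uᴴ := by
  refine ⟨hA.eigenvectorUnitary, ?_, ?_, hA.eigenvalues, ?_⟩
  · exact Unitary.coe_star_mul_self _
  · exact Unitary.coe_mul_star_self _
  · exact hA.spectral_theorem

theorem posSemidef_unitary_diagonal_iff {U : Matrix n n ℂ} (h : Uᴴ * U = 1) {l : n → ℝ} :
    (U * diagonal (fun i => (l i : ℂ)) * Uᴴ).PosSemidef ↔ ∀ i, 0 ≤ l i := by
  have h' : U * Uᴴ = 1 := mul_eq_one_comm.1 h
  have hU : IsUnit U := IsUnit.of_mul_eq_one _ h'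
  rw [← star_eq_conjTranspose, hU.posSemidef_star_right_conjugate_iff, posSemidef_diagonal_iff]
  simp

theorem posDef_unitary_diagonal_iff {U : Matrix n n ℂ} (h : Uᴴ * U = 1) {l : n → ℝ} :
    (U * diagonal (fun i => (l i : ℂ)) * Uᴴ).PosDef ↔ ∀ i, 0 < l i := by
  have h' : U * Uᴴ = 1 := mul_eq_one_comm.1 h
  have hU : IsUnit U := IsUnit.of_mul_eq_one _ h'
  rw [← star_eq_conjTranspose, hU.posDef_star_right_conjugate_iff, posDef_diagonal_iff]
  simp

theorem rank_unitary_diagonal {U : Matrix n n ℂ} (h : Uᴴ * U = 1) (l : n → ℝ) :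
    (U * diagonal (fun i => (l i : ℂ)) * Uᴴ).rank = Fintype.card {i // l i ≠ 0} := by
  have h' : U * Uᴴ = 1 := mul_eq_one_comm.1 h
  rw [rank_mul_eq_left_of_isUnit_det _ _ ((isUnit_iff_isUnit_det _).1 (IsUnit.of_mul_eq_one _ h)),
    rank_mul_eq_right_of_isUnit_det _ _ ((isUnit_iff_isUnit_det _).1 (IsUnit.of_mul_eq_one _ h')),
    rank_diagonal]
  simp

theorem unitary_diagonal_mul {U : Matrix n n ℂ} (h : Uᴴ * U = 1) (a b : n → ℂ) :
    (U * diagonal a * Uᴴ) * (U * diagonal b * Uᴴ) = U * diagonal (fun i => a i * b i) * Uᴴ := by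
  rw [← diagonal_mul_diagonal]
  calc _ = U * diagonal a * (Uᴴ * U) * diagonal b * Uᴴ := by simp only [Matrix.mul_assoc]
    _ = _ := by rw [h]; simp only [Matrix.mul_assoc, Matrix.one_mul]

theorem IsHermitian.exists_smul_one_sub {A : Matrix n n ℂ} (hA : A.IsHermitian) :
    ∃ C : ℝ, 0 < C ∧ ((C : ℂ) • (1 : Matrix n n ℂ) - A).PosSemidef := by
  obtain ⟨U, h1, h2, l, rfl⟩ := hA.exists_unitary_diagonal
  refine ⟨1 + ∑ i, |l i|, by positivity, ?_⟩
  have : ((1 + ∑ i, |l i| : ℝ) : ℂ) • (1 : Matrix n n ℂ) - U * diagonal (fun i => (l i : ℂ)) * Uᴴ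
      = U * diagonal (fun i => (((1 + ∑ i, |l i|) - l i : ℝ) : ℂ)) * Uᴴ := by
    have e : diagonal (fun i => (((1 + ∑ i, |l i|) - l i : ℝ) : ℂ))
      = ((1 + ∑ i, |l i| : ℝ) : ℂ) • (1 : Matrix n n ℂ) - diagonal (fun i => (l i : ℂ)) := by
      ext i j
      by_cases hij : i = j
      · subst hij; simp
      · simp [hij]
    rw [e, Matrix.mul_sub, Matrix.sub_mul]
    simp [h2]
  rw [this, posSemidef_unitary_diagonal_iff h1]
  intro i
  have := Finset.single_le_sum (f := fun i => |l i|) (fun i _ => abs_nonneg _) (Finset.mem_univ i)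
  have := le_abs_self (l i)
  linarith

/-- The support projection `P` of a positive semidefinite matrix `X`. -/
theorem PosSemidef.exists_support {X : Matrix n n ℂ} (hX : X.PosSemidef) :
    ∃ P B : Matrix n n ℂ, IsStarProjection P ∧ P.rank = X.rank ∧ P = X * B ∧ P * X = X ∧
      ∃ C : ℝ, 0 < C ∧ ((C : ℂ) • X - P).PosSemidef := by
  obtain ⟨U, h1, h2, l, rfl⟩ := hX.1.exists_unitary_diagonal
  rw [posSemidef_unitary_diagonal_iff h1] at hX
  -- Since `0⁻¹ = 0`, the second matrix is the pseudo-inverse of `X`. The constant dominates every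
  -- `1 / l i`; the summand `1` keeps it positive when `X = 0`.
  refine ⟨U * diagonal (fun i => ((if l i = 0 then 0 else 1 : ℝ) : ℂ)) * Uᴴ,
    U * diagonal (fun i => (((l i)⁻¹ : ℝ) : ℂ)) * Uᴴ, ⟨?_, ?_⟩, ?_, ?_, ?_,
    1 + ∑ i, (l i)⁻¹, ?_, ?_⟩
  · rw [IsIdempotentElem, unitary_diagonal_mul h1]
    congr; ext i; by_cases h : l i = 0 <;> simp [h]
  · rw [isSelfAdjoint_iff, star_eq_conjTranspose]
    simp only [conjTranspose_mul, conjTranspose_conjTranspose, diagonal_conjTranspose,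
      Matrix.mul_assoc]
    congr; ext i; simp only [Pi.star_apply, RCLike.star_def, Complex.conj_ofReal]
  · rw [rank_unitary_diagonal h1, rank_unitary_diagonal h1]
    exact Fintype.card_congr (Equiv.subtypeEquivRight fun i => by by_cases h : l i = 0 <;> simp [h])
  · rw [unitary_diagonal_mul h1]
    congr; ext i
    by_cases h : l i = 0 <;> simp [h]
  · rw [unitary_diagonal_mul h1]
    congr; ext i
    by_cases h : l i = 0 <;> simp [h]
  · have : 0 ≤ ∑ i, (l i)⁻¹ := Finset.sum_nonneg fun i _ => inv_nonneg.2 (hX i)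
    linarith
  · have e : ((1 + ∑ i, (l i)⁻¹ : ℝ) : ℂ) • (U * diagonal (fun i => (l i : ℂ)) * Uᴴ)
        - U * diagonal (fun i => ((if l i = 0 then 0 else 1 : ℝ) : ℂ)) * Uᴴ
        = U * diagonal (fun i => (((1 + ∑ i, (l i)⁻¹) * l i - (if l i = 0 then 0 else 1) : ℝ) : ℂ))
          * Uᴴ := by
      have : diagonal (fun i => (((1 + ∑ i, (l i)⁻¹) * l i - (if l i = 0 then 0 else 1) : ℝ) : ℂ))
          = ((1 + ∑ i, (l i)⁻¹ : ℝ) : ℂ) • diagonal (fun i => (l i : ℂ))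
            - diagonal (fun i => ((if l i = 0 then 0 else 1 : ℝ) : ℂ)) := by
        ext i j
        by_cases hij : i = j
        · subst hij; simp
        · simp [hij]
      rw [this, Matrix.mul_sub, Matrix.sub_mul]
      simp
    rw [e, posSemidef_unitary_diagonal_iff h1]
    intro i
    by_cases h : l i = 0
    · simp [h]
    · have h3 : (l i)⁻¹ ≤ ∑ i, (l i)⁻¹ := Finset.single_le_sum (f := fun i => (l i)⁻¹)
        (fun i _ => inv_nonneg.2 (hX i)) (Finset.mem_univ i)
      have h4 := mul_le_mul_of_nonneg_right h3 (hX i)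
      rw [inv_mul_cancel₀ h] at h4
      have := hX i
      simp only [h, if_false]
      linarith

/-- The support projection of an invertible `X` is `1`, so `C X ≥ 1` and `D C X ≥ D ≥ H`. -/
theorem PosDef.exists_smul_sub {X H : Matrix n n ℂ} (hX : X.PosDef) (hH : H.IsHermitian) :
    ∃ C : ℝ, 0 < C ∧ ((C : ℂ) • X - H).PosSemidef := by
  obtain ⟨P, B, hP, -, -, hPX, C, hC, h⟩ := hX.posSemidef.exists_support
  obtain ⟨D, hD, h'⟩ := hH.exists_smul_one_sub
  have : P = 1 := hX.isUnit.mul_right_cancel (by rw [hPX, one_mul])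
  subst this
  refine ⟨D * C, by positivity, ?_⟩
  have h2 : ((D : ℂ) • ((C : ℂ) • X - 1)).PosSemidef := h.smul (by exact_mod_cast hD.le)
  convert! h2.add h' using 1
  push_cast
  rw [smul_sub, mul_smul]
  abel

theorem PosSemidef.trace_mul_nonneg {A B : Matrix n n ℂ} (hA : A.PosSemidef) (hB : B.PosSemidef) :
    0 ≤ (A * B).trace := by
  obtain ⟨C, rfl⟩ : ∃ C : Matrix n n ℂ, A = C * Cᴴ := by
    obtain ⟨U, h1, h2, l, rfl⟩ := hA.1.exists_unitary_diagonal
    rw [posSemidef_unitary_diagonal_iff h1] at hA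
    refine ⟨U * diagonal (fun i => ((√(l i) : ℝ) : ℂ)), ?_⟩
    rw [conjTranspose_mul, diagonal_conjTranspose]
    simp only [Matrix.mul_assoc]
    rw [← Matrix.mul_assoc (diagonal _) (diagonal _), diagonal_mul_diagonal]
    congr; ext i
    simp only [Pi.star_apply, RCLike.star_def, Complex.conj_ofReal, ← Complex.ofReal_mul]
    rw [Real.mul_self_sqrt (hA i)]
  rw [Matrix.mul_assoc, trace_mul_comm]
  exact (hB.conjTranspose_mul_mul_same C).trace_nonneg

/-- A Hermitian `H` is the difference of `C • 1` and `C • 1 - H`; real and imaginary parts do the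
rest. Linear identities may thus be checked on semidefinite matrices. -/
theorem span_posSemidef :
    Submodule.span ℂ {X : Matrix n n ℂ | X.PosSemidef} = ⊤ := by
  have herm : ∀ H : Matrix n n ℂ, H.IsHermitian →
      H ∈ Submodule.span ℂ {X : Matrix n n ℂ | X.PosSemidef} := by
    intro H hH
    obtain ⟨C, hC, h⟩ := hH.exists_smul_one_sub
    have : H = (C : ℂ) • (1 : Matrix n n ℂ) - ((C : ℂ) • (1 : Matrix n n ℂ) - H) := by abel
    rw [this]
    exact Submodule.sub_mem _ (Submodule.smul_mem _ _ (Submodule.subset_span PosSemidef.one))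
      (Submodule.subset_span h)
  rw [eq_top_iff]
  rintro A -
  rw [← realPart_add_I_smul_imaginaryPart A]
  exact Submodule.add_mem _ (herm _ (realPart A).2)
    (Submodule.smul_mem _ _ (herm _ (imaginaryPart A).2))

theorem linearMap_eq_of_posSemidef {E : Type*} [AddCommGroup E] [Module ℂ E]
    {f g : Matrix n n ℂ →ₗ[ℂ] E} (h : ∀ X, X.PosSemidef → f X = g X) : f = g :=
  LinearMap.ext_on span_posSemidef fun X hX => h X hX

/-- The eigenvalues lie in `[0, 1]`, so each is at most the indicator of being nonzero; equality of
the sums forces each to be `0` or `1`. -/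
theorem PosSemidef.trace_re_le_rank {B : Matrix n n ℂ} (hB : B.PosSemidef)
    (hB1 : (1 - B).PosSemidef) :
    B.trace.re ≤ B.rank ∧ (B.trace = B.rank → IsStarProjection B) := by
  have hsa : IsSelfAdjoint B := hB.1
  obtain ⟨U, h1, h2, l, rfl⟩ := hB.1.exists_unitary_diagonal
  rw [posSemidef_unitary_diagonal_iff h1] at hB
  have e : 1 - U * diagonal (fun i => (l i : ℂ)) * Uᴴ
      = U * diagonal (fun i => ((1 - l i : ℝ) : ℂ)) * Uᴴ := by
    have : diagonal (fun i => ((1 - l i : ℝ) : ℂ)) = 1 - diagonal (fun i => (l i : ℂ)) := by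
      rw [← diagonal_one, diagonal_sub]; simp
    rw [this, Matrix.mul_sub, Matrix.sub_mul]
    simp [h2]
  rw [e, posSemidef_unitary_diagonal_iff h1] at hB1
  have htr : (U * diagonal (fun i => (l i : ℂ)) * Uᴴ).trace = ((∑ i, l i : ℝ) : ℂ) := by
    rw [trace_mul_cycle, h1, Matrix.one_mul, trace_diagonal]; simp
  have hrk : ((U * diagonal (fun i => (l i : ℂ)) * Uᴴ).rank : ℝ)
      = ∑ i, if l i = 0 then (0 : ℝ) else 1 := by
    rw [rank_unitary_diagonal h1, Fintype.card_subtype, Finset.sum_ite]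
    simp
  have hle : ∀ i ∈ Finset.univ, l i ≤ if l i = 0 then (0 : ℝ) else 1 := by
    intro i _
    have := hB1 i
    split_ifs with h
    · exact h.le
    · linarith
  constructor
  · rw [htr, hrk, Complex.ofReal_re]
    exact Finset.sum_le_sum hle
  · intro heq
    rw [htr] at heq
    have heq' : (∑ i, l i) = ∑ i, if l i = 0 then (0 : ℝ) else 1 := by
      rw [← hrk]; exact_mod_cast heq
    rw [Finset.sum_eq_sum_iff_of_le hle] at heq'
    refine ⟨?_, hsa⟩
    rw [IsIdempotentElem, unitary_diagonal_mul h1]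
    congr; ext i
    have := heq' i (Finset.mem_univ i)
    split_ifs at this with h
    · simp [this]
    · simp [this]

theorem PosDef.exists_eq_mul_conjTranspose {X : Matrix n n ℂ} (hX : X.PosDef) :
    ∃ B : Matrix n n ℂ, IsUnit B ∧ X = B * Bᴴ := by
  obtain ⟨U, h1, h2, l, rfl⟩ := hX.1.exists_unitary_diagonal
  have hl := (posDef_unitary_diagonal_iff h1).1 hX
  have e : U * diagonal (fun i => (l i : ℂ)) * Uᴴ = (U * diagonal (fun i => ((√(l i) : ℝ) : ℂ))) *
      (U * diagonal (fun i => ((√(l i) : ℝ) : ℂ)))ᴴ := by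
    rw [conjTranspose_mul, diagonal_conjTranspose]
    simp only [Matrix.mul_assoc]
    rw [← Matrix.mul_assoc (diagonal _) (diagonal _), diagonal_mul_diagonal]
    congr; ext i
    simp only [Pi.star_apply, RCLike.star_def, Complex.conj_ofReal, ← Complex.ofReal_mul]
    rw [Real.mul_self_sqrt (hl i).le]
  refine ⟨_, ?_, e⟩
  have := hX.isUnit
  rw [e, isUnit_iff_isUnit_det, det_mul] at this
  rw [isUnit_iff_isUnit_det]
  exact isUnit_of_mul_isUnit_left this

end General

end Matrix

/-! ### Positive maps and the semidefinite order -/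

namespace MatrixMap

variable {k m : ℕ} {T : Matrix (Fin k) (Fin k) ℂ →ₗ[ℂ] Matrix (Fin m) (Fin m) ℂ}

theorem IsPositive.smul_sub (hT : IsPositive T) {A B : Matrix (Fin k) (Fin k) ℂ} {C : ℂ}
    (h : (C • B - A).PosSemidef) : (C • T B - T A).PosSemidef := by
  have := hT _ h
  rwa [map_sub, map_smul] at this

theorem IsPositive.posDef (hT : IsPositive T) (hT1 : (T 1).PosDef)
    {X : Matrix (Fin k) (Fin k) ℂ} (hX : X.PosDef) : (T X).PosDef := by
  obtain ⟨C, -, h⟩ := hX.exists_smul_sub (H := 1) isHermitian_one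
  exact (hT _ hX.posSemidef).posDef_of_smul_sub hT1 (hT.smul_sub h)

end MatrixMap

open Filter Topology

/-! ### Compactness of density matrices and the derivative of the determinant -/

namespace Matrix

section Compactness

variable {n : Type*} [Fintype n] [DecidableEq n]

theorem isCompact_unitary : IsCompact {U : Matrix n n ℂ | Uᴴ * U = 1} := by
  have h : IsCompact (Set.univ.pi fun _ : n => Set.univ.pi fun _ : n =>
      Metric.closedBall (0 : ℂ) 1) :=
    isCompact_univ_pi fun _ => isCompact_univ_pi fun _ => isCompact_closedBall _ _
  refine IsCompact.of_isClosed_subset (s := Set.univ.pi fun _ : n => Set.univ.pi fun _ : n =>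
      Metric.closedBall (0 : ℂ) 1) h ?_ ?_
  · exact isClosed_eq (by fun_prop) continuous_const
  · intro U hU i _ j _
    have : U ∈ unitaryGroup n ℂ := mem_unitaryGroup_iff'.2 hU
    simpa using entry_norm_bound_of_unitary this i j

/-- By the spectral theorem this set is the continuous image of unitaries times the standard
simplex. -/
theorem isCompact_density : IsCompact {X : Matrix n n ℂ | X.PosSemidef ∧ X.trace = 1} := by
  have h := (isCompact_unitary (n := n)).prod (isCompact_stdSimplex ℝ n)
  have hc : Continuous fun x : Matrix n n ℂ × (n → ℝ) =>
      x.1 * diagonal (fun i => (x.2 i : ℂ)) * x.1ᴴ := by fun_prop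
  convert! h.image hc using 1
  ext X
  constructor
  · rintro ⟨hX, htr⟩
    obtain ⟨U, h1, h2, l, rfl⟩ := hX.1.exists_unitary_diagonal
    refine ⟨(U, l), ⟨h1, (posSemidef_unitary_diagonal_iff h1).1 hX, ?_⟩, rfl⟩
    rw [trace_mul_cycle, h1, Matrix.one_mul, trace_diagonal] at htr
    exact_mod_cast htr
  · rintro ⟨⟨U, l⟩, ⟨h1, h2, h3⟩, rfl⟩
    refine ⟨(posSemidef_unitary_diagonal_iff h1).2 h2, ?_⟩
    simp only [Set.mem_ofPred_eq] at h1
    simp only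
    rw [trace_mul_cycle, h1, Matrix.one_mul, trace_diagonal]
    exact_mod_cast h3

theorem hasDerivAt_det_one_add (M : Matrix n n ℂ) :
    HasDerivAt (fun t : ℝ => (1 + (t : ℂ) • M).det) M.trace 0 := by
  have h := (det (1 + (Polynomial.X : Polynomial ℂ) • M.map Polynomial.C)).hasDerivAt (0 : ℂ)
  rw [derivative_det_one_add_X_smul] at h
  have e : ∀ z : ℂ, Polynomial.eval z (det (1 + (Polynomial.X : Polynomial ℂ) • M.map Polynomial.C))
      = (1 + z • M).det := by
    intro z
    rw [← Polynomial.coe_evalRingHom, RingHom.map_det]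
    congr 1
    ext i j
    by_cases hij : i = j
    · subst hij; simp; exact mul_comm _ _
    · simp [hij]; exact mul_comm _ _
  simp only [e] at h
  have h' : HasDerivAt (fun z : ℂ => (1 + z • M).det) M.trace ((0 : ℝ) : ℂ) := by simpa using h
  exact h'.comp_ofReal

theorem PosSemidef.eq_re_of_trace_mul {A B : Matrix n n ℂ} (hA : A.PosSemidef) (hB : B.PosSemidef) :
    (A * B).trace = ((A * B).trace.re : ℂ) :=
  Complex.ext (by simp) (by simpa using (Complex.nonneg_iff.1 (hA.trace_mul_nonneg hB)).2.symm)

theorem det_add_smul {X : Matrix n n ℂ} (hX : X.PosDef) (H : Matrix n n ℂ) (t : ℂ) :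
    (X + t • H).det = X.det * (1 + t • (X⁻¹ * H)).det := by
  rw [← det_mul, Matrix.mul_add, Matrix.mul_one, Matrix.mul_smul, ← Matrix.mul_assoc,
    mul_nonsing_inv _ ((isUnit_iff_isUnit_det _).1 hX.isUnit), Matrix.one_mul]

end Compactness

end Matrix

theorem nonneg_of_hasDerivAt_of_nonneg {f : ℝ → ℝ} {d : ℝ} (h : HasDerivAt f d 0) (h0 : f 0 = 0)
    (hf : ∀ t, 0 ≤ t → 0 ≤ f t) : 0 ≤ d := by
  refine ge_of_tendsto h.tendsto_slope_zero_right ?_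
  filter_upwards [self_mem_nhdsWithin] with t ht
  rw [h0, zero_add, sub_zero, smul_eq_mul]
  exact mul_nonneg (inv_nonneg.2 (le_of_lt ht)) (hf t (le_of_lt ht))

/-! ### Maximizing the determinant quotient -/

namespace MatrixMap

variable {k m : ℕ} {T : Matrix (Fin k) (Fin k) ℂ →ₗ[ℂ] Matrix (Fin m) (Fin m) ℂ}

/-- `X` is a critical point of `X ↦ det (X) ^ m / det (T X) ^ k`. -/
structure IsScalingPoint (T : Matrix (Fin k) (Fin k) ℂ →ₗ[ℂ] Matrix (Fin m) (Fin m) ℂ)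
    (X : Matrix (Fin k) (Fin k) ℂ) : Prop where
  posDef : X.PosDef
  map_posDef : (T X).PosDef
  trace_eq : ∀ H, (k : ℂ) * ((T X)⁻¹ * T H).trace = m * (X⁻¹ * H).trace

/-- Numerator and denominator of `det(X)^m / det(T X)^k` are both homogeneous of degree `k m`, so
the maximum over the compact set of density matrices is global. It is positive, hence not attained
at a singular matrix. -/
theorem exists_isMax (hk : 0 < k) (hm : 0 < m)
    (hT : ∀ X : Matrix (Fin k) (Fin k) ℂ, X.PosSemidef → X ≠ 0 → (T X).PosDef) :
    ∃ X : Matrix (Fin k) (Fin k) ℂ, X.PosDef ∧ X.trace = 1 ∧ ∀ Z : Matrix (Fin k) (Fin k) ℂ,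
      Z.PosDef → ‖Z.det‖ ^ m * ‖(T X).det‖ ^ k ≤ ‖X.det‖ ^ m * ‖(T Z).det‖ ^ k := by
  have : Nonempty (Fin k) := ⟨⟨0, hk⟩⟩
  set K := {X : Matrix (Fin k) (Fin k) ℂ | X.PosSemidef ∧ X.trace = 1}
  have hK0 : ∀ X ∈ K, X ≠ 0 := by
    rintro X ⟨-, h⟩ rfl
    simp at h
  have hdet : ∀ X ∈ K, 0 < ‖(T X).det‖ := fun X hX =>
    norm_pos_iff.2 (hT X hX.1 (hK0 X hX)).det_pos.ne'
  have hmem : ∀ Z : Matrix (Fin k) (Fin k) ℂ, Z.PosDef → Z.trace⁻¹ • Z ∈ K := by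
    intro Z hZ
    have h0 : 0 < Z.trace := hZ.trace_pos
    refine ⟨hZ.posSemidef.smul (inv_nonneg_of_nonneg h0.le), ?_⟩
    rw [trace_smul, smul_eq_mul, inv_mul_cancel₀ h0.ne']
  have hTc : Continuous T := T.continuous_of_finiteDimensional
  have hcont : ContinuousOn (fun X => ‖X.det‖ ^ m / ‖(T X).det‖ ^ k) K := by
    refine ContinuousOn.div (Continuous.continuousOn (by fun_prop))
      (Continuous.continuousOn (by fun_prop)) fun X hX => (pow_pos (hdet X hX) _).ne'
  obtain ⟨X, hX, hmax⟩ := isCompact_density.exists_isMaxOn ⟨_, hmem 1 PosDef.one⟩ hcont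
  have hmax' : ∀ Z : Matrix (Fin k) (Fin k) ℂ, Z.PosDef →
      ‖Z.det‖ ^ m * ‖(T X).det‖ ^ k ≤ ‖X.det‖ ^ m * ‖(T Z).det‖ ^ k := by
    intro Z hZ
    have h := hmax (hmem Z hZ)
    have h0 : 0 < ‖Z.trace⁻¹‖ := norm_pos_iff.2 (inv_ne_zero hZ.trace_pos.ne')
    have hZ' : Z ≠ 0 := by rintro rfl; exact hZ.trace_pos.ne' (by simp)
    simp only [Set.mem_ofPred_eq, map_smul, det_smul, Fintype.card_fin, norm_mul, norm_pow,
      mul_pow, ← pow_mul] at h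
    rw [mul_comm m k, mul_div_mul_left _ _ (pow_pos h0 _).ne',
      div_le_div_iff₀ (pow_pos (norm_pos_iff.2 (hT Z hZ.posSemidef hZ').det_pos.ne') _)
        (pow_pos (hdet X hX) _)] at h
    exact h
  refine ⟨X, ?_, hX.2, hmax'⟩
  rw [hX.1.posDef_iff_det_ne_zero]
  intro h0
  have h := hmax (hmem 1 PosDef.one)
  have h1 : 0 < ‖((1 : Matrix (Fin k) (Fin k) ℂ).trace⁻¹ • (1 : Matrix (Fin k) (Fin k) ℂ)).det‖ := by
    rw [det_smul, det_one, mul_one, norm_pow]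
    refine pow_pos (norm_pos_iff.2 (inv_ne_zero ?_)) _
    simpa using hk.ne'
  have h2 : 0 < ‖((1 : Matrix (Fin k) (Fin k) ℂ).trace⁻¹ • (1 : Matrix (Fin k) (Fin k) ℂ)).det‖ ^ m
      / ‖(T ((1 : Matrix (Fin k) (Fin k) ℂ).trace⁻¹ • (1 : Matrix (Fin k) (Fin k) ℂ))).det‖ ^ k :=
    div_pos (pow_pos h1 _) (pow_pos (hdet _ (hmem 1 PosDef.one)) _)
  simp only [Set.mem_ofPred_eq] at h
  rw [h0, norm_zero, zero_pow hm.ne', zero_div] at h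
  exact absurd h2 (not_lt.2 h)

theorem norm_det_of_posDef {n : Type*} [Fintype n] [DecidableEq n] {X : Matrix n n ℂ}
    (hX : X.PosDef) : X.det = (‖X.det‖ : ℂ) :=
  (Complex.norm_of_nonneg' hX.det_pos.le).symm

/-- Along `X + t H`, maximality says that `q(t)^k - p(t)^m ≥ 0` for the normalized determinants `p`
and `q` of `X + t H` and its image. This difference vanishes at `0`, so its derivative there is
nonnegative. Only `t ≥ 0` is available for keeping `X + t H` positive definite. -/
theorem trace_le_of_isMax {X : Matrix (Fin k) (Fin k) ℂ} (hX : X.PosDef) (hTp : IsPositive T)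
    (hTX : (T X).PosDef)
    (hmax : ∀ Z : Matrix (Fin k) (Fin k) ℂ,
      Z.PosDef → ‖Z.det‖ ^ m * ‖(T X).det‖ ^ k ≤ ‖X.det‖ ^ m * ‖(T Z).det‖ ^ k)
    {H : Matrix (Fin k) (Fin k) ℂ} (hH : H.PosSemidef) :
    m * (X⁻¹ * H).trace.re ≤ k * ((T X)⁻¹ * T H).trace.re := by
  set p := fun t : ℝ => (1 + (t : ℂ) • (X⁻¹ * H)).det with hp
  set q := fun t : ℝ => (1 + (t : ℂ) • ((T X)⁻¹ * T H)).det with hq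
  have dp : HasDerivAt (fun t => (p t).re) (X⁻¹ * H).trace.re 0 :=
    Complex.reCLM.hasFDerivAt.comp_hasDerivAt _ (hasDerivAt_det_one_add (X⁻¹ * H))
  have dq : HasDerivAt (fun t => (q t).re) ((T X)⁻¹ * T H).trace.re 0 :=
    Complex.reCLM.hasFDerivAt.comp_hasDerivAt _ (hasDerivAt_det_one_add ((T X)⁻¹ * T H))
  have p0 : p 0 = 1 := by simp [hp]
  have q0 : q 0 = 1 := by simp [hq]
  have d := (dq.pow k).sub (dp.pow m)
  have := nonneg_of_hasDerivAt_of_nonneg d (by simp [p0, q0]) ?_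
  · simp only [p0, q0, Complex.one_re, one_pow, mul_one] at this
    linarith
  intro t ht
  have ht' : (0 : ℂ) ≤ t := by exact_mod_cast ht
  have hXH : (X + (t : ℂ) • H).PosDef := hX.add_posSemidef (hH.smul ht')
  have hTXH : (T X + (t : ℂ) • T H).PosDef := hTX.add_posSemidef ((hTp H hH).smul ht')
  have key : ∀ {n : ℕ} {X H : Matrix (Fin n) (Fin n) ℂ}, X.PosDef → (X + (t : ℂ) • H).PosDef →
      ((1 + (t : ℂ) • (X⁻¹ * H)).det).re = ‖(X + (t : ℂ) • H).det‖ / ‖X.det‖ := by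
    intro n X H hX hXH
    have h := det_add_smul hX H t
    have h0 : ‖X.det‖ ≠ 0 := norm_ne_zero_iff.2 hX.det_pos.ne'
    rw [norm_det_of_posDef hXH, norm_det_of_posDef hX] at h
    have h' := congrArg Complex.re h
    rw [Complex.re_ofReal_mul, Complex.ofReal_re] at h'
    rw [h']
    field_simp
  have hm := hmax _ hXH
  have h1 : 0 < ‖X.det‖ := norm_pos_iff.2 hX.det_pos.ne'
  have h2 : 0 < ‖(T X).det‖ := norm_pos_iff.2 hTX.det_pos.ne'
  simp only [Pi.sub_apply, Pi.pow_apply, hp, hq]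
  rw [key hX hXH, key hTX hTXH, div_pow, div_pow, sub_nonneg,
    div_le_div_iff₀ (pow_pos h1 _) (pow_pos h2 _)]
  rw [map_add, map_smul] at hm
  linarith

theorem exists_isScalingPoint_of_posDef (hk : 0 < k) (hm : 0 < m) (hTp : IsPositive T)
    (hT : ∀ X : Matrix (Fin k) (Fin k) ℂ, X.PosSemidef → X ≠ 0 → (T X).PosDef) :
    ∃ X : Matrix (Fin k) (Fin k) ℂ, IsScalingPoint T X ∧ X.trace = 1 := by
  obtain ⟨X, hX, htr, hmax⟩ := exists_isMax hk hm hT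
  have hX0 : X ≠ 0 := by rintro rfl; simp at htr
  have hTX := hT X hX.posSemidef hX0
  have hle := fun {H} => trace_le_of_isMax hX hTp hTX hmax (H := H)
  have hXX : (X⁻¹ * X).trace = k := by
    rw [nonsing_inv_mul _ ((isUnit_iff_isUnit_det _).1 hX.isUnit)]; simp
  have hTT : ((T X)⁻¹ * T X).trace = m := by
    rw [nonsing_inv_mul _ ((isUnit_iff_isUnit_det _).1 hTX.isUnit)]; simp
  refine ⟨X, ⟨hX, hTX, ?_⟩, htr⟩
  have hlin : (k : ℂ) • (traceLinearMap (Fin m) ℂ ℂ ∘ₗ LinearMap.mulLeft ℂ (T X)⁻¹ ∘ₗ T)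
      = (m : ℂ) • (traceLinearMap (Fin k) ℂ ℂ ∘ₗ LinearMap.mulLeft ℂ X⁻¹) := by
    refine linearMap_eq_of_posSemidef fun H hH => ?_
    -- The inequality is an equality at `X`, both sides being `k m`. Applied to `C X - H` it
    -- therefore gives the reverse inequality for `H`.
    obtain ⟨C, hC, hCH⟩ := hX.exists_smul_sub hH.1
    have h1 := hle hH
    have h2 := hle hCH
    rw [map_sub, map_smul, Matrix.mul_sub, Matrix.mul_sub, Matrix.mul_smul, Matrix.mul_smul,
      trace_sub, trace_sub, trace_smul, trace_smul, hXX, hTT] at h2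
    simp only [smul_eq_mul, Complex.sub_re, Complex.re_ofReal_mul, Complex.natCast_re] at h2
    have h3 : (k : ℝ) * ((T X)⁻¹ * T H).trace.re = m * (X⁻¹ * H).trace.re := by nlinarith
    simp only [LinearMap.smul_apply, LinearMap.comp_apply, LinearMap.mulLeft_apply,
      traceLinearMap_apply, smul_eq_mul]
    rw [hX.inv.posSemidef.eq_re_of_trace_mul hH, hTX.inv.posSemidef.eq_re_of_trace_mul (hTp H hH)]
    exact_mod_cast h3
  intro H
  simpa using LinearMap.congr_fun hlin H

end MatrixMap

/-! ### Limits of spectral decompositions along an ultrafilter -/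

namespace Matrix

section Limits

variable {n ι : Type*} [Fintype n] [DecidableEq n]

theorem exists_tendsto_unitary (F : Ultrafilter ι) {U : ι → Matrix n n ℂ}
    (hU : ∀ a, (U a)ᴴ * U a = 1) : ∃ V : Matrix n n ℂ, Vᴴ * V = 1 ∧ Tendsto U F (𝓝 V) := by
  obtain ⟨V, hV, h⟩ := isCompact_unitary.ultrafilter_le_nhds (F.map U)
    (le_principal_iff.2 (Filter.mem_map.2 (Filter.univ_mem' fun a => hU a)))
  exact ⟨V, hV, h⟩

/-- Compactness makes the eigenvector matrices converge along the ultrafilter; the eigenvalues,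
being the diagonal of `Uᴴ X U`, then converge too. -/
theorem exists_tendsto_spectral (F : Ultrafilter ι) {X : ι → Matrix n n ℂ} {X₀ : Matrix n n ℂ}
    (hX : ∀ a, (X a).IsHermitian) (h : Tendsto X F (𝓝 X₀)) :
    ∃ (U : ι → Matrix n n ℂ) (l : ι → n → ℝ) (U₀ : Matrix n n ℂ) (l₀ : n → ℝ),
      (∀ a, (U a)ᴴ * U a = 1) ∧ (∀ a, X a = U a * diagonal (fun i => (l a i : ℂ)) * (U a)ᴴ) ∧
      U₀ᴴ * U₀ = 1 ∧ X₀ = U₀ * diagonal (fun i => (l₀ i : ℂ)) * U₀ᴴ ∧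
      Tendsto U F (𝓝 U₀) ∧ Tendsto l F (𝓝 l₀) := by
  choose U hU1 hU2 l hl using fun a => (hX a).exists_unitary_diagonal
  obtain ⟨U₀, hU₀, hlim⟩ := exists_tendsto_unitary F hU1
  have hd : ∀ a, diagonal (fun i => (l a i : ℂ)) = (U a)ᴴ * X a * U a := by
    intro a
    conv_rhs => rw [hl a]
    calc _ = ((U a)ᴴ * U a) * diagonal (fun i => (l a i : ℂ)) * ((U a)ᴴ * U a) := by
          rw [hU1]; simp
      _ = _ := by simp only [Matrix.mul_assoc]
  have hstar : Tendsto (fun a => (U a)ᴴ) F (𝓝 U₀ᴴ) :=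
    (continuous_id.matrix_conjTranspose.tendsto U₀).comp hlim
  have hdl : Tendsto (fun a => diagonal (fun i => (l a i : ℂ))) F (𝓝 (U₀ᴴ * X₀ * U₀)) := by
    simp only [hd]
    exact (hstar.mul h).mul hlim
  have hl' : Tendsto l F (𝓝 fun i => ((U₀ᴴ * X₀ * U₀) i i).re) := by
    rw [tendsto_pi_nhds]
    intro i
    have h1 := (Complex.continuous_re.tendsto _).comp
      (((continuous_id.matrix_elem i i).tendsto _).comp hdl)
    refine h1.congr fun a => ?_
    simp
  refine ⟨U, l, U₀, _, hU1, hl, hU₀, ?_, hlim, hl'⟩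
  have hdl' : Tendsto (fun a => diagonal (fun i => (l a i : ℂ))) F
      (𝓝 (diagonal fun i => (((U₀ᴴ * X₀ * U₀) i i).re : ℂ))) := by
    have hc : Continuous fun x : n → ℝ => diagonal (fun i => (x i : ℂ)) := by fun_prop
    exact (hc.tendsto _).comp hl'
  refine tendsto_nhds_unique h ?_
  exact ((hlim.mul hdl').mul hstar).congr fun a => (hl a).symm

theorem tendsto_inv {F : Filter ι} {X : ι → Matrix n n ℂ} {X₀ : Matrix n n ℂ}
    (h : Tendsto X F (𝓝 X₀)) (h0 : IsUnit X₀) : Tendsto (fun a => (X a)⁻¹) F (𝓝 X₀⁻¹) := by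
  simp only [inv_def, Ring.inverse_eq_inv']
  have hd : X₀.det ≠ 0 := ((isUnit_iff_isUnit_det _).1 h0).ne_zero
  exact (((continuous_id.matrix_det.tendsto _).comp h).inv₀ hd).smul
    ((continuous_id.matrix_adjugate.tendsto _).comp h)

theorem inv_unitary_diagonal {U : Matrix n n ℂ} (h : Uᴴ * U = 1) {l : n → ℝ}
    (hl : ∀ i, 0 < l i) :
    (U * diagonal (fun i => (l i : ℂ)) * Uᴴ)⁻¹ = U * diagonal (fun i => ((l i)⁻¹ : ℂ)) * Uᴴ := by
  refine inv_eq_right_inv ?_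
  rw [unitary_diagonal_mul h]
  have : (fun i => (l i : ℂ) * (l i : ℂ)⁻¹) = fun _ => 1 := by
    ext i
    exact mul_inv_cancel₀ (by exact_mod_cast (hl i).ne')
  rw [this, diagonal_one, Matrix.mul_one, mul_eq_one_comm.1 h]

/-- Lower semicontinuity of `tr (D⁻¹ B)` at a common limit of `B` and `D`. -/
theorem rank_le_of_tendsto_trace_inv_mul (F : Ultrafilter ι) {D B : ι → Matrix n n ℂ}
    {D₀ : Matrix n n ℂ} (hD : ∀ a, (D a).PosDef) (hB : ∀ a, (B a).PosSemidef)
    (hDl : Tendsto D F (𝓝 D₀)) (hBl : Tendsto B F (𝓝 D₀)) {c : ℝ}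
    (hc : ∀ a, ((D a)⁻¹ * B a).trace.re ≤ c) : (D₀.rank : ℝ) ≤ c := by
  obtain ⟨V, μ, V₀, μ₀, hV, hDV, hV₀, rfl, hVl, hμl⟩ :=
    exists_tendsto_spectral F (fun a => (hD a).1) hDl
  have hμ : ∀ a i, 0 < μ a i := fun a => (posDef_unitary_diagonal_iff (hV a)).1 (hDV a ▸ hD a)
  have htr : ∀ a, ((D a)⁻¹ * B a).trace.re = ∑ i, (μ a i)⁻¹ * (((V a)ᴴ * B a * V a) i i).re := by
    intro a
    rw [hDV a, inv_unitary_diagonal (hV a) (hμ a), Matrix.mul_assoc, Matrix.mul_assoc,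
      trace_mul_comm, Matrix.mul_assoc, trace, Complex.re_sum]
    refine Finset.sum_congr rfl fun i _ => ?_
    rw [diag_apply, diagonal_mul, ← Complex.ofReal_inv, Complex.re_ofReal_mul]
  have hnn : ∀ a i, 0 ≤ (((V a)ᴴ * B a * V a) i i).re := fun a i =>
    (Complex.nonneg_iff.1 ((hB a).conjTranspose_mul_mul_same (V a)).diag_nonneg).1
  -- Indices with `μ₀ i = 0` have unbounded `(μ a i)⁻¹`; their terms are nonnegative and can be
  -- dropped. Each remaining term tends to `1`, so the limit counts the rank.
  have hle : ∀ a, ∑ i with μ₀ i ≠ 0, (μ a i)⁻¹ * (((V a)ᴴ * B a * V a) i i).re ≤ c := by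
    intro a
    refine le_trans ?_ (htr a ▸ hc a)
    exact Finset.sum_le_sum_of_subset_of_nonneg (Finset.subset_univ _)
      fun i _ _ => mul_nonneg (inv_nonneg.2 (hμ a i).le) (hnn a i)
  have hstar : Tendsto (fun a => (V a)ᴴ) F (𝓝 V₀ᴴ) :=
    (continuous_id.matrix_conjTranspose.tendsto V₀).comp hVl
  have hlim := (hstar.mul hBl).mul hVl
  have e : V₀ᴴ * (V₀ * diagonal (fun i => (μ₀ i : ℂ)) * V₀ᴴ) * V₀
      = diagonal (fun i => (μ₀ i : ℂ)) := by
    calc _ = (V₀ᴴ * V₀) * diagonal (fun i => (μ₀ i : ℂ)) * (V₀ᴴ * V₀) := by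
          simp only [Matrix.mul_assoc]
      _ = _ := by rw [hV₀]; simp
  rw [e] at hlim
  have hsum : Tendsto (fun a => ∑ i with μ₀ i ≠ 0, (μ a i)⁻¹ * (((V a)ᴴ * B a * V a) i i).re) F
      (𝓝 (∑ i with μ₀ i ≠ 0, (μ₀ i)⁻¹ * μ₀ i)) := by
    refine tendsto_finsetSum _ fun i hi => ?_
    have h0 : μ₀ i ≠ 0 := (Finset.mem_filter.1 hi).2
    refine ((tendsto_pi_nhds.1 hμl i).inv₀ h0).mul ?_
    have h1 := (Complex.continuous_re.tendsto _).comp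
      (((continuous_id.matrix_elem i i).tendsto _).comp hlim)
    simpa [Function.comp_def] using h1
  have hval : ∑ i with μ₀ i ≠ 0, (μ₀ i)⁻¹ * μ₀ i
      = ((V₀ * diagonal (fun i => (μ₀ i : ℂ)) * V₀ᴴ).rank : ℝ) := by
    rw [rank_unitary_diagonal hV₀, Fintype.card_subtype,
      Finset.sum_congr rfl fun i hi => inv_mul_cancel₀ (Finset.mem_filter.1 hi).2]
    simp
  rw [← hval]
  exact le_of_tendsto hsum (Filter.Eventually.of_forall hle)

end Limits

end Matrix

/-! ### Scaling points from the strict rank inequality -/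

namespace MatrixMap

variable {k m : ℕ} {T : Matrix (Fin k) (Fin k) ℂ →ₗ[ℂ] Matrix (Fin m) (Fin m) ℂ}

/-- The perturbation `X ↦ T X + ε tr (X) Id`. -/
def perturb (T : Matrix (Fin k) (Fin k) ℂ →ₗ[ℂ] Matrix (Fin m) (Fin m) ℂ) (ε : ℝ) :
    Matrix (Fin k) (Fin k) ℂ →ₗ[ℂ] Matrix (Fin m) (Fin m) ℂ :=
  T + (ε : ℂ) • (traceLinearMap (Fin k) ℂ ℂ).smulRight 1

theorem perturb_apply (T : Matrix (Fin k) (Fin k) ℂ →ₗ[ℂ] Matrix (Fin m) (Fin m) ℂ) (ε : ℝ)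
    (X : Matrix (Fin k) (Fin k) ℂ) : perturb T ε X = T X + ((ε : ℂ) * X.trace) • 1 := by
  simp [perturb, mul_smul]

theorem IsPositive.perturb (hT : IsPositive T) {ε : ℝ} (hε : 0 ≤ ε) :
    IsPositive (perturb T ε) := by
  intro X hX
  rw [perturb_apply]
  exact (hT X hX).add (PosSemidef.one.smul (mul_nonneg (by exact_mod_cast hε) hX.trace_nonneg))

theorem IsPositive.perturb_posDef (hT : IsPositive T) {ε : ℝ} (hε : 0 < ε)
    {X : Matrix (Fin k) (Fin k) ℂ} (hX : X.PosSemidef) (hX0 : X ≠ 0) :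
    (MatrixMap.perturb T ε X).PosDef := by
  rw [perturb_apply]
  have htr : 0 < X.trace := lt_of_le_of_ne hX.trace_nonneg fun h => hX0 (hX.trace_eq_zero_iff.1 h.symm)
  exact PosDef.posSemidef_add (hT X hX) (PosDef.one.smul (mul_pos (by exact_mod_cast hε) htr))

theorem tendsto_perturb {ι : Type*} {F : Filter ι} {ε : ι → ℝ} {X : ι → Matrix (Fin k) (Fin k) ℂ}
    {X₀ : Matrix (Fin k) (Fin k) ℂ} (hε : Tendsto ε F (𝓝 0)) (hX : Tendsto X F (𝓝 X₀)) :
    Tendsto (fun a => perturb T (ε a) (X a)) F (𝓝 (T X₀)) := by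
  simp only [perturb_apply]
  have h1 : Tendsto (fun a => T (X a)) F (𝓝 (T X₀)) :=
    (T.continuous_of_finiteDimensional.tendsto _).comp hX
  have h2 : Tendsto (fun a => (X a).trace) F (𝓝 X₀.trace) :=
    (continuous_id.matrix_trace.tendsto _).comp hX
  have h3 : Tendsto (fun a => (ε a : ℂ)) F (𝓝 ((0 : ℝ) : ℂ)) :=
    (Complex.continuous_ofReal.tendsto _).comp hε
  simpa using h1.add ((h3.mul h2).smul_const (1 : Matrix (Fin m) (Fin m) ℂ))

/-- Scaling points of the perturbations have a limit `X₀` of trace one. The critical equations pass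
to the limit if `X₀` is invertible, and the rank hypothesis excludes a singular `X₀`. -/
theorem exists_isScalingPoint (hk : 0 < k) (hm : 0 < m) (hT : IsPositive T) (hT1 : (T 1).PosDef)
    (hrank : ∀ X : Matrix (Fin k) (Fin k) ℂ, X.PosSemidef → 0 < X.rank → X.rank < k →
      X.rank * m < (T X).rank * k) :
    ∃ X, IsScalingPoint T X := by
  set ε : ℕ → ℝ := fun a => 1 / ((a : ℝ) + 1)
  have hε : ∀ a, 0 < ε a := fun a => Nat.one_div_pos_of_nat
  set F : Ultrafilter ℕ := hyperfilter ℕ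
  have hεl : Tendsto ε F (𝓝 0) :=
    tendsto_one_div_add_atTop_nhds_zero_nat.mono_left Nat.hyperfilter_le_atTop
  choose X hXs hXtr using fun a => exists_isScalingPoint_of_posDef hk hm (hT.perturb (hε a).le)
    (fun Z hZ hZ0 => hT.perturb_posDef (hε a) hZ hZ0)
  obtain ⟨X₀, ⟨hX₀, hX₀tr⟩, hXl⟩ := isCompact_density.ultrafilter_le_nhds (F.map X)
    (le_principal_iff.2 (Filter.mem_map.2 (Filter.univ_mem' fun a =>
      (⟨(hXs a).posDef.posSemidef, hXtr a⟩ : (X a).PosSemidef ∧ (X a).trace = 1))))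
  replace hXl : Tendsto X F (𝓝 X₀) := hXl
  have hDl := tendsto_perturb (T := T) hεl hXl
  obtain ⟨U, l, U₀, l₀, hU, hXU, hU₀, rfl, hUl, hll⟩ :=
    exists_tendsto_spectral F (fun a => (hXs a).posDef.1) hXl
  have hl : ∀ a i, 0 < l a i :=
    fun a => (posDef_unitary_diagonal_iff (hU a)).1 (hXU a ▸ (hXs a).posDef)
  have hl₀ : ∀ i, 0 ≤ l₀ i := (posSemidef_unitary_diagonal_iff hU₀).1 hX₀
  set X₀ := U₀ * diagonal (fun i => (l₀ i : ℂ)) * U₀ᴴ with hX₀def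
  have hr := rank_unitary_diagonal hU₀ l₀
  rw [← hX₀def] at hr
  by_cases hpos : ∀ i, l₀ i ≠ 0
  · have hX₀d : X₀.PosDef :=
      (posDef_unitary_diagonal_iff hU₀).2 fun i => lt_of_le_of_ne (hl₀ i) (hpos i).symm
    have hTX₀ := hT.posDef hT1 hX₀d
    refine ⟨X₀, hX₀d, hTX₀, fun H => ?_⟩
    have h1 := tendsto_inv hDl hTX₀.isUnit
    have h2 := tendsto_inv hXl hX₀d.isUnit
    have h3 := tendsto_perturb (T := T) hεl (tendsto_const_nhds (x := H))
    have h4 := ((continuous_id.matrix_trace.tendsto _).comp (h1.mul h3)).const_mul (k : ℂ)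
    have h5 := ((continuous_id.matrix_trace.tendsto _).comp
      (h2.mul (tendsto_const_nhds (x := H)))).const_mul (m : ℂ)
    exact tendsto_nhds_unique (h4.congr fun a => (hXs a).trace_eq H) h5
  · exfalso
    push Not at hpos
    obtain ⟨i₀, hi₀⟩ := hpos
    have hrk : X₀.rank < k := by
      rw [hr]
      conv_rhs => rw [← Fintype.card_fin k]
      exact Fintype.card_subtype_lt (x := i₀) (by simpa using hi₀)
    have hr0 : 0 < X₀.rank := by
      rw [hr, Fintype.card_pos_iff]
      by_contra hne
      have h0 : ∀ i, l₀ i = 0 := fun i => by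
        by_contra h
        exact hne ⟨⟨i, h⟩⟩
      have : X₀ = 0 := by simp [hX₀def, h0]
      rw [this] at hX₀tr
      simp at hX₀tr
    -- `A a` keeps only the eigenvalues of `X a` with nonzero limit. It has the same limit `X₀` as
    -- `X a`, while `(X a)⁻¹ * A a` is a projection of rank `X₀.rank`.
    set j : Fin k → ℝ := fun i => if l₀ i = 0 then 0 else 1 with hj
    set A : ℕ → Matrix (Fin k) (Fin k) ℂ :=
      fun a => U a * diagonal (fun i => ((l a i * j i : ℝ) : ℂ)) * (U a)ᴴ with hA
    have hApos : ∀ a, (A a).PosSemidef := fun a =>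
      (posSemidef_unitary_diagonal_iff (hU a)).2 fun i =>
        mul_nonneg (hl a i).le (by simp only [hj]; split_ifs <;> norm_num)
    have hAl : Tendsto A F (𝓝 X₀) := by
      have hstar : Tendsto (fun a => (U a)ᴴ) F (𝓝 U₀ᴴ) :=
        (continuous_id.matrix_conjTranspose.tendsto U₀).comp hUl
      have hc : Continuous fun x : Fin k → ℝ => diagonal (fun i => ((x i * j i : ℝ) : ℂ)) := by
        fun_prop
      have h := (hUl.mul ((hc.tendsto _).comp hll)).mul hstar
      have e : (fun i => ((l₀ i * j i : ℝ) : ℂ)) = fun i => (l₀ i : ℂ) := by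
        ext i
        by_cases h : l₀ i = 0 <;> simp [hj, h]
      rwa [e] at h
    have htr : ∀ a, ((X a)⁻¹ * A a).trace = X₀.rank := by
      intro a
      have e : A a = X a * (U a * diagonal (fun i => (j i : ℂ)) * (U a)ᴴ) := by
        rw [hXU a, unitary_diagonal_mul (hU a)]
        simp [hA]
      rw [e, ← Matrix.mul_assoc,
        nonsing_inv_mul _ ((isUnit_iff_isUnit_det _).1 (hXs a).posDef.isUnit), Matrix.one_mul,
        trace_mul_cycle, hU a, Matrix.one_mul, trace_diagonal, hr, Fintype.card_subtype]
      simp only [hj]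
      rw [← Complex.ofReal_sum, Finset.sum_ite]
      simp
    have hBl := tendsto_perturb (T := T) hεl hAl
    have hk' : (0 : ℝ) < k := by exact_mod_cast hk
    -- The perturbed images of `X a` and `A a` share the limit `T X₀`, and the critical equation at
    -- `A a` fixes the trace at `m * X₀.rank / k`.
    have hle := rank_le_of_tendsto_trace_inv_mul F (fun a => (hXs a).map_posDef)
      (fun a => (hT.perturb (hε a).le) (A a) (hApos a)) hDl hBl (c := m * X₀.rank / k) fun a => by
        have h := (hXs a).trace_eq (A a)
        rw [htr a] at h
        have h' := congrArg Complex.re h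
        rw [← Complex.ofReal_natCast, Complex.re_ofReal_mul] at h'
        rw [le_div_iff₀ hk']
        simp only [Complex.mul_re, Complex.natCast_re, Complex.natCast_im] at h'
        linarith
    rw [le_div_iff₀ hk'] at hle
    have hlt := hrank X₀ hX₀ hr0 hrk
    have : (T X₀).rank * k ≤ m * X₀.rank := by exact_mod_cast hle
    linarith

end MatrixMap

/-! ### From a scaling point to a doubly stochastic map -/

namespace MatrixMap

variable {k m : ℕ} {T : Matrix (Fin k) (Fin k) ℂ →ₗ[ℂ] Matrix (Fin m) (Fin m) ℂ}

/-- The map `X ↦ D * T (C * X * Cᴴ) * Dᴴ`. -/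
def conj {k m k' m' : ℕ} (C : Matrix (Fin k) (Fin k') ℂ) (D : Matrix (Fin m') (Fin m) ℂ)
    (T : Matrix (Fin k) (Fin k) ℂ →ₗ[ℂ] Matrix (Fin m) (Fin m) ℂ) :
    Matrix (Fin k') (Fin k') ℂ →ₗ[ℂ] Matrix (Fin m') (Fin m') ℂ where
  toFun X := D * T (C * X * Cᴴ) * Dᴴ
  map_add' X Y := by simp [Matrix.mul_add, Matrix.add_mul]
  map_smul' _ _ := by simp

theorem conj_apply {k m k' m' : ℕ} (C : Matrix (Fin k) (Fin k') ℂ) (D : Matrix (Fin m') (Fin m) ℂ)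
    (T : Matrix (Fin k) (Fin k) ℂ →ₗ[ℂ] Matrix (Fin m) (Fin m) ℂ) (X : Matrix (Fin k') (Fin k') ℂ) :
    conj C D T X = D * T (C * X * Cᴴ) * Dᴴ := rfl

theorem IsPositive.conj {k' m' : ℕ} (hT : IsPositive T) (C : Matrix (Fin k) (Fin k') ℂ)
    (D : Matrix (Fin m') (Fin m) ℂ) : IsPositive (conj C D T) := fun _ hX =>
  (hT _ (hX.mul_mul_conjTranspose_same C)).mul_mul_conjTranspose_same D

theorem adjoint_one_eq_iff (d : ℝ) :
    adjoint T 1 = (d : ℂ) • 1 ↔ ∀ Z, (T Z).trace = d * Z.trace := by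
  have h := fun Z => trace_mul_adjoint T Z 1
  simp only [conjTranspose_one, Matrix.mul_one] at h
  constructor
  · intro h1 Z
    rw [h Z, h1]
    simp
  · intro h1
    refine conjTranspose_injective (ext_iff_trace_mul_left.2 fun Z => ?_)
    rw [← h Z, h1 Z]
    simp

theorem isDoublyStochastic_iff (hk : 0 < k) (hm : 0 < m) :
    IsDoublyStochastic T ↔ IsPositive T ∧ T 1 = ((√k / √m : ℝ) : ℂ) • 1 ∧
      ∀ Z, (T Z).trace = ((√m / √k : ℝ) : ℂ) * Z.trace := by
  have hk' : ((√k : ℝ) : ℂ) ≠ 0 := by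
    exact_mod_cast (Real.sqrt_pos.2 (by exact_mod_cast hk : (0 : ℝ) < k)).ne'
  have hm' : ((√m : ℝ) : ℂ) ≠ 0 := by
    exact_mod_cast (Real.sqrt_pos.2 (by exact_mod_cast hm : (0 : ℝ) < m)).ne'
  rw [IsDoublyStochastic, ← adjoint_one_eq_iff, map_smul, map_smul, inv_smul_eq_iff₀ hk',
    inv_smul_eq_iff₀ hm', smul_smul, smul_smul]
  push_cast
  rw [div_eq_mul_inv, div_eq_mul_inv]

/-- Conjugating by square-root factors of `X` and `T X` normalizes the value at `1`; the trace
condition is the critical equation at `C * Z * Cᴴ`. -/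
theorem IsScalingPoint.exists_equivalent (hk : 0 < k) (hm : 0 < m) (hT : IsPositive T)
    {X : Matrix (Fin k) (Fin k) ℂ} (hX : IsScalingPoint T X) :
    ∃ S, Equivalent T S ∧ IsDoublyStochastic S := by
  obtain ⟨C, hC, hXC⟩ := hX.posDef.exists_eq_mul_conjTranspose
  obtain ⟨B, hB, hTB⟩ := hX.map_posDef.exists_eq_mul_conjTranspose
  have hkR : (0 : ℝ) < k := by exact_mod_cast hk
  have hmR : (0 : ℝ) < m := by exact_mod_cast hm
  have hc : 0 < √(k : ℝ) / √m := div_pos (Real.sqrt_pos.2 hkR) (Real.sqrt_pos.2 hmR)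
  -- Double stochasticity prescribes `c • 1` as the image of `1`; a factor `√c` goes to each side.
  set c := √(k : ℝ) / √m with hcdef
  have hsc : ((√c : ℝ) : ℂ) ≠ 0 := by exact_mod_cast (Real.sqrt_pos.2 hc).ne'
  have hscc : ((√c : ℝ) : ℂ) * ((√c : ℝ) : ℂ) = (c : ℂ) := by
    rw [← Complex.ofReal_mul, Real.mul_self_sqrt hc.le]
  have hBd := (isUnit_iff_isUnit_det _).1 hB
  have hCd := (isUnit_iff_isUnit_det _).1 hC
  have hBH : IsUnit Bᴴ.det := by rw [det_conjTranspose]; exact hBd.star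
  have hCH : IsUnit Cᴴ.det := by rw [det_conjTranspose]; exact hCd.star
  set D := ((√c : ℝ) : ℂ) • B⁻¹ with hD
  have hDH : Dᴴ = ((√c : ℝ) : ℂ) • (Bᴴ)⁻¹ := by
    rw [hD, conjTranspose_smul, conjTranspose_nonsing_inv, RCLike.star_def, Complex.conj_ofReal]
  have hDu : IsUnit D := by
    rw [isUnit_iff_isUnit_det, hD, det_smul]
    exact (hsc.isUnit.pow _).mul (isUnit_nonsing_inv_det _ hBd)
  refine ⟨conj C D T, ⟨C, D, hC, hDu, fun Z => rfl⟩, ?_⟩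
  rw [isDoublyStochastic_iff hk hm]
  refine ⟨hT.conj C D, ?_, fun Z => ?_⟩
  · rw [conj_apply, Matrix.mul_one, ← hXC, hTB, hDH, hD, Matrix.smul_mul, Matrix.mul_smul,
      Matrix.smul_mul, smul_smul, hscc, ← Matrix.mul_assoc, nonsing_inv_mul _ hBd, Matrix.one_mul,
      mul_nonsing_inv _ hBH]
  · have h := hX.trace_eq (C * Z * Cᴴ)
    have h1 : (X⁻¹ * (C * Z * Cᴴ)).trace = Z.trace := by
      rw [hXC, Matrix.mul_inv_rev]
      calc _ = ((Cᴴ)⁻¹ * (C⁻¹ * C) * Z * Cᴴ).trace := by simp only [Matrix.mul_assoc]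
        _ = (Cᴴ * (Cᴴ)⁻¹ * Z).trace := by
          rw [nonsing_inv_mul _ hCd, Matrix.mul_one, trace_mul_comm, Matrix.mul_assoc]
        _ = _ := by rw [mul_nonsing_inv _ hCH, Matrix.one_mul]
    have h2 : (conj C D T Z).trace = c * ((T X)⁻¹ * T (C * Z * Cᴴ)).trace := by
      rw [conj_apply, hDH, hD, hTB, Matrix.mul_inv_rev, trace_mul_comm, Matrix.smul_mul, Matrix.smul_mul,
        Matrix.mul_smul, smul_smul, hscc, trace_smul, smul_eq_mul]
      simp only [Matrix.mul_assoc]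
    rw [h1] at h
    rw [h2]
    have hk0 : (k : ℂ) ≠ 0 := by exact_mod_cast hk.ne'
    have h3 : ((T X)⁻¹ * T (C * Z * Cᴴ)).trace = (m / k : ℝ) * Z.trace := by
      push_cast
      field_simp
      linear_combination h
    rw [h3, ← mul_assoc, ← Complex.ofReal_mul]
    congr 2
    rw [hcdef]
    have e1 := Real.mul_self_sqrt hkR.le
    have e2 := Real.mul_self_sqrt hmR.le
    have p1 := (Real.sqrt_pos.2 hkR).ne'
    have p2 := (Real.sqrt_pos.2 hmR).ne'
    rw [div_mul_div_comm, div_eq_div_iff (mul_ne_zero p2 hkR.ne') p1]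
    linear_combination (-√(k : ℝ) * √m * √m + √(k:ℝ) * √m * √m + m) * e1 - k * e2

end MatrixMap

/-! ### Frames adapted to direct sums that need not be orthogonal -/

namespace Matrix

/-- The columns of the matrices `J i` form a basis of `ℂ^k`, and the rows of the left inverses
form the dual basis. -/
structure IsFrame {k s : ℕ} {v : Fin s → ℕ} (J : ∀ i, Matrix (Fin k) (Fin (v i)) ℂ)
    (J' : ∀ i, Matrix (Fin (v i)) (Fin k) ℂ) : Prop where
  mul_self : ∀ i, J' i * J i = 1
  mul_of_ne : ∀ i j, i ≠ j → J' i * J j = 0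
  sum_mul : ∑ i, J i * J' i = 1

/-- Bases of the summands are collected into one basis: `J i` includes the `i`-th coordinates and
`J' i` reads them off. `J' i` need not be `(J i)ᴴ`, and `J i * J' i` is the oblique projection along
the other summands. -/
theorem exists_isFrame {k s : ℕ} {V : Fin s → Matrix (Fin k) (Fin k) ℂ}
    (hV : ∀ i, IsStarProjection (V i))
    (h : DirectSum.IsInternal (fun i => MatrixMap.image (V i))) :
    ∃ (J : ∀ i, Matrix (Fin k) (Fin (V i).rank) ℂ) (J' : ∀ i, Matrix (Fin (V i).rank) (Fin k) ℂ),
      IsFrame J J' ∧ (∀ i, V i * J i = J i) ∧ ∀ i, J i * J' i * V i = V i := by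
  let b : ∀ i, Module.Basis (Fin (V i).rank) ℂ (MatrixMap.image (V i)) :=
    fun i => Module.finBasisOfFinrankEq ℂ _ rfl
  let c := h.collectedBasis b
  let L : ∀ i, (Fin (V i).rank → ℂ) →ₗ[ℂ] (Fin k → ℂ) :=
    fun i => (MatrixMap.image (V i)).subtype ∘ₗ (b i).equivFun.symm.toLinearMap
  let L' : ∀ i, (Fin k → ℂ) →ₗ[ℂ] (Fin (V i).rank → ℂ) :=
    fun i => LinearMap.funLeft ℂ ℂ (fun j => (⟨i, j⟩ : Σ i, Fin (V i).rank)) ∘ₗ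
      c.equivFun.toLinearMap
  have hL' : ∀ i x j, L' i x j = c.repr x ⟨i, j⟩ := fun i x j => rfl
  have hL : ∀ i x, L i x = ((b i).equivFun.symm x : Fin k → ℂ) := fun i x => rfl
  have hLmem : ∀ i x, L i x ∈ MatrixMap.image (V i) := fun i x => ((b i).equivFun.symm x).2
  have hL'mem : ∀ i x (hx : x ∈ MatrixMap.image (V i)), L' i x = (b i).equivFun ⟨x, hx⟩ := by
    intro i x hx
    ext j
    rw [hL', h.collectedBasis_repr_of_mem b hx]
    rfl
  refine ⟨fun i => LinearMap.toMatrix' (L i), fun i => LinearMap.toMatrix' (L' i),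
    ⟨fun i => ?_, fun i j hij => ?_, ?_⟩, fun i => ?_, fun i => ?_⟩
  · rw [← LinearMap.toMatrix'_comp, ← LinearMap.toMatrix'_id]
    congr 1
    ext1 x
    refine LinearMap.ext fun y => ?_
    simp only [LinearMap.comp_apply]
    rw [hL'mem i _ (hLmem i _)]
    exact (b i).equivFun.apply_symm_apply _
  · rw [← LinearMap.toMatrix'_comp, ← map_zero LinearMap.toMatrix']
    congr 1
    refine LinearMap.ext fun x => ?_
    ext a
    simp only [LinearMap.comp_apply, hL']
    exact h.collectedBasis_repr_of_mem_ne b hij.symm (hLmem j x)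
  · simp only [← LinearMap.toMatrix'_comp]
    rw [← map_sum, ← LinearMap.toMatrix'_id]
    congr 1
    refine LinearMap.ext fun x => ?_
    rw [LinearMap.sum_apply, LinearMap.id_apply]
    conv_rhs => rw [← c.sum_repr x, Fintype.sum_sigma]
    refine Finset.sum_congr rfl fun i _ => ?_
    rw [LinearMap.comp_apply, hL, Module.Basis.equivFun_symm_apply, Submodule.coe_sum]
    refine Finset.sum_congr rfl fun j _ => ?_
    simp [hL', c]
  · refine toLin'.injective (LinearMap.ext fun x => ?_)
    rw [toLin'_apply, toLin'_apply, ← mulVec_mulVec, LinearMap.toMatrix'_mulVec]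
    obtain ⟨z, hz⟩ := hLmem i x
    rw [← hz, mulVecLin_apply, mulVec_mulVec, (hV i).isIdempotentElem.eq]
  · refine toLin'.injective (LinearMap.ext fun x => ?_)
    rw [toLin'_apply, toLin'_apply, ← mulVec_mulVec, ← mulVec_mulVec, LinearMap.toMatrix'_mulVec,
      LinearMap.toMatrix'_mulVec, hL'mem i (V i *ᵥ x) ⟨x, rfl⟩, hL, LinearEquiv.symm_apply_apply]

theorem rank_mul_mul_conjTranspose {k v : ℕ} {J : Matrix (Fin k) (Fin v) ℂ}
    {J' : Matrix (Fin v) (Fin k) ℂ} (h : J' * J = 1) (X : Matrix (Fin v) (Fin v) ℂ) :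
    (J * X * Jᴴ).rank = X.rank := by
  refine le_antisymm ((rank_mul_le_left _ _).trans (rank_mul_le_right _ _)) ?_
  have h2 : Jᴴ * J'ᴴ = 1 := by rw [← conjTranspose_mul, h, conjTranspose_one]
  have e : X = J' * (J * X * Jᴴ) * J'ᴴ := by
    calc X = (J' * J) * X * (Jᴴ * J'ᴴ) := by rw [h, h2]; simp
      _ = _ := by simp only [Matrix.mul_assoc]
  conv_lhs => rw [e]
  exact (rank_mul_le_left _ _).trans (rank_mul_le_right _ _)

namespace IsFrame

variable {k s : ℕ} {v : Fin s → ℕ} {J : ∀ i, Matrix (Fin k) (Fin (v i)) ℂ}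
  {J' : ∀ i, Matrix (Fin (v i)) (Fin k) ℂ}

theorem sum_mul_sum (h : IsFrame J J') (A B : ∀ i, Matrix (Fin (v i)) (Fin (v i)) ℂ)
    (hAB : ∀ i, A i * B i = 1) :
    (∑ i, J i * A i * (J i)ᴴ) * (∑ i, (J' i)ᴴ * B i * J' i) = 1 := by
  rw [← h.sum_mul, Finset.sum_mul]
  refine Finset.sum_congr rfl fun i _ => ?_
  rw [Finset.mul_sum, Finset.sum_eq_single i]
  · calc _ = J i * A i * (J' i * J i)ᴴ * B i * J' i := by
          rw [conjTranspose_mul]; simp only [Matrix.mul_assoc]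
      _ = _ := by rw [h.mul_self, conjTranspose_one, Matrix.mul_one, Matrix.mul_assoc (J i), hAB,
        Matrix.mul_one]
  · intro j _ hj
    calc _ = J i * A i * (J' j * J i)ᴴ * B j * J' j := by
          rw [conjTranspose_mul]; simp only [Matrix.mul_assoc]
      _ = _ := by rw [h.mul_of_ne j i hj]; simp
  · simp

theorem inv_sum (h : IsFrame J J') {A : ∀ i, Matrix (Fin (v i)) (Fin (v i)) ℂ}
    (hA : ∀ i, (A i).PosDef) :
    (∑ i, J i * A i * (J i)ᴴ)⁻¹ = ∑ i, (J' i)ᴴ * (A i)⁻¹ * J' i :=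
  inv_eq_right_inv (h.sum_mul_sum _ _ fun i =>
    mul_nonsing_inv _ ((isUnit_iff_isUnit_det _).1 (hA i).isUnit))

theorem posDef_sum (h : IsFrame J J') {A : ∀ i, Matrix (Fin (v i)) (Fin (v i)) ℂ}
    (hA : ∀ i, (A i).PosDef) : (∑ i, J i * A i * (J i)ᴴ).PosDef := by
  have hs : (∑ i, J i * A i * (J i)ᴴ).PosSemidef :=
    posSemidef_sum _ fun i _ => (hA i).posSemidef.mul_mul_conjTranspose_same _
  rw [hs.posDef_iff_isUnit]
  exact IsUnit.of_mul_eq_one _ (h.sum_mul_sum _ _ fun i =>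
    mul_nonsing_inv _ ((isUnit_iff_isUnit_det _).1 (hA i).isUnit))

end IsFrame

end Matrix

/-! ### Gluing the scaling points of the blocks -/

namespace MatrixMap

variable {k m : ℕ} {T : Matrix (Fin k) (Fin k) ℂ →ₗ[ℂ] Matrix (Fin m) (Fin m) ℂ}

theorem IsPositive.map_conjTranspose (hT : IsPositive T) (X : Matrix (Fin k) (Fin k) ℂ) :
    T Xᴴ = (T X)ᴴ := by
  have hX : X ∈ Submodule.span ℂ {X : Matrix (Fin k) (Fin k) ℂ | X.PosSemidef} := by
    rw [span_posSemidef]; trivial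
  induction hX using Submodule.span_induction with
  | mem X hX => rw [hX.1.eq, (hT X hX).1.eq]
  | zero => simp
  | add X Y _ _ h1 h2 => simp [h1, h2]
  | smul c X _ h => rw [conjTranspose_smul, map_smul, map_smul, conjTranspose_smul, h]

/-- `xᴴ T*(M) x = tr(T(x xᴴ) M)` is the trace of a product of two semidefinite matrices. -/
theorem IsPositive.adjoint_posSemidef (hT : IsPositive T) {M : Matrix (Fin m) (Fin m) ℂ}
    (hM : M.PosSemidef) : (adjoint T M).PosSemidef := by
  have hH : (adjoint T M).IsHermitian := by
    refine ext_iff_trace_mul_left.2 fun A => ?_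
    have h2 : star ((A * adjoint T M).trace) = (T Aᴴ * Mᴴ).trace := by
      rw [trace_mul_adjoint, ← trace_conjTranspose, conjTranspose_mul, trace_mul_comm]
    rw [← trace_mul_adjoint, ← star_inj, h2, hT.map_conjTranspose, ← trace_conjTranspose,
      conjTranspose_mul, conjTranspose_conjTranspose, hM.1.eq, trace_mul_comm]
  refine PosSemidef.of_dotProduct_mulVec_nonneg hH fun x => ?_
  have h1 : star x ⬝ᵥ adjoint T M *ᵥ x = (vecMulVec x (star x) * (adjoint T M)ᴴ).trace := by
    rw [hH.eq, trace_mul_comm, mul_vecMulVec, trace_vecMulVec, dotProduct_comm]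
  rw [h1, ← trace_mul_adjoint, hM.1.eq]
  exact (hT _ (posSemidef_vecMulVec_self_star x)).trace_mul_nonneg hM

/-- The hypothesis says that the semidefinite matrix `Jᴴ T*(M) J` has trace zero, so it vanishes,
and the columns of `J` lie in the kernel of `T*(M)`. -/
theorem IsPositive.adjoint_mul_eq_zero (hT : IsPositive T) {M : Matrix (Fin m) (Fin m) ℂ}
    (hM : M.PosSemidef) {v : ℕ} {J : Matrix (Fin k) (Fin v) ℂ}
    (h : (T (J * Jᴴ) * M).trace = 0) : adjoint T M * J = 0 := by
  have hG := hT.adjoint_posSemidef hM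
  have h0 : Jᴴ * adjoint T M * J = 0 := by
    rw [← (hG.conjTranspose_mul_mul_same J).trace_eq_zero_iff, trace_mul_cycle, ← h]
    conv_rhs => rw [← hM.1.eq]
    rw [trace_mul_adjoint, hG.1.eq]
  refine toLin'.injective (LinearMap.ext fun x => ?_)
  rw [toLin'_apply, ← mulVec_mulVec, map_zero, LinearMap.zero_apply,
    ← hG.dotProduct_mulVec_zero_iff, star_mulVec, ← dotProduct_mulVec, mulVec_mulVec, mulVec_mulVec, h0]
  simp

/-- This discards the off-diagonal blocks of `H`, on which `T` is not controlled directly. The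
semidefinite matrix `G = T*(Dᴴ Z D)` kills every `J j` with `j ≠ i`, so `G` absorbs `J i * J' i` on
the right and its adjoint on the left. -/
theorem IsPositive.trace_conjTranspose_mul_mul_mul (hT : IsPositive T) {s : ℕ} {v : Fin s → ℕ}
    {J : ∀ i, Matrix (Fin k) (Fin (v i)) ℂ} {J' : ∀ i, Matrix (Fin (v i)) (Fin k) ℂ}
    (hJ : IsFrame J J') {w : ℕ} (D : Matrix (Fin w) (Fin m) ℂ) {Z : Matrix (Fin w) (Fin w) ℂ}
    (hZ : Z.PosSemidef) {i : Fin s} (hD : ∀ j, j ≠ i → D * T (J j * (J j)ᴴ) = 0)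
    (H : Matrix (Fin k) (Fin k) ℂ) :
    (Dᴴ * Z * D * T H).trace = (Z * MatrixMap.conj (J i) D T (J' i * H * (J' i)ᴴ)).trace := by
  set M := Dᴴ * Z * D with hM
  have hMpos : M.PosSemidef := hZ.conjTranspose_mul_mul_same _
  set G := adjoint T M with hG
  have hGpos : G.PosSemidef := hT.adjoint_posSemidef hMpos
  have htrG : ∀ A, (M * T A).trace = (A * G).trace := by
    intro A
    have := trace_mul_adjoint T A M
    rwa [← hG, hMpos.1.eq, hGpos.1.eq, trace_mul_comm] at this
  have hGJ : ∀ j, j ≠ i → G * J j = 0 := by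
    intro j hj
    refine hT.adjoint_mul_eq_zero hMpos ?_
    rw [trace_mul_comm, hM, Matrix.mul_assoc, hD j hj, Matrix.mul_zero, trace_zero]
  have hGE : G * (J i * J' i) = G := by
    calc _ = ∑ j, G * (J j * J' j) := by
          rw [Finset.sum_eq_single i]
          · intro j _ hj
            rw [← Matrix.mul_assoc, hGJ j hj, Matrix.zero_mul]
          · simp
      _ = _ := by rw [← Finset.mul_sum, hJ.sum_mul, Matrix.mul_one]
  have hEG : (J i * J' i)ᴴ * G = G := by
    have := congrArg conjTranspose hGE
    rwa [conjTranspose_mul, hGpos.1.eq] at this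
  have e1 : (M * T H).trace = (M * T (J i * (J' i * H * (J' i)ᴴ) * (J i)ᴴ)).trace := by
    rw [htrG, htrG]
    conv_lhs => rw [← hGE, ← hEG]
    calc _ = ((H * (J i * J' i)ᴴ * G) * (J i * J' i)).trace := by simp only [Matrix.mul_assoc]
      _ = _ := by
        rw [trace_mul_comm, conjTranspose_mul]
        simp only [Matrix.mul_assoc]
  rw [e1, hM, Matrix.mul_assoc, Matrix.mul_assoc, trace_mul_comm, conj_apply]
  simp only [Matrix.mul_assoc]

/-- In frame coordinates each block is a positive map `R i` satisfying the strict rank inequality.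
Dual frames invert the glued matrices blockwise, and the common ratio `m / k` lets the block
equations add up. -/
theorem exists_isScalingPoint_of_decomposition (hm : 0 < m) (hT : IsPositive T)
    (hT1 : (T 1).PosDef) {s : ℕ} {V : Fin s → Matrix (Fin k) (Fin k) ℂ}
    {W : Fin s → Matrix (Fin m) (Fin m) ℂ}
    (hV : ∀ i, IsStarProjection (V i)) (hW : ∀ i, IsStarProjection (W i))
    (hVi : DirectSum.IsInternal (fun i => image (V i)))
    (hWi : DirectSum.IsInternal (fun i => image (W i)))
    (hVW : ∀ i, Set.MapsTo T (corner (V i)) (corner (W i)))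
    (hrank : ∀ i, ∀ X ∈ corner (V i), X.PosSemidef → 0 < X.rank → X.rank < (V i).rank →
      X.rank * (W i).rank < (T X).rank * (V i).rank)
    (hpos : ∀ i, 0 < (V i).rank) (hratio : ∀ i, (W i).rank * k = m * (V i).rank) :
    ∃ X, IsScalingPoint T X := by
  obtain ⟨J, J', hJ, hVJ, hJV⟩ := exists_isFrame hV hVi
  obtain ⟨L, L', hL, hWL, hLW⟩ := exists_isFrame hW hWi
  have hmemJ : ∀ i (X : Matrix (Fin (V i).rank) (Fin (V i).rank) ℂ), J i * X * (J i)ᴴ ∈ corner (V i) := by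
    intro i X
    have h1 : (J i)ᴴ * V i = (J i)ᴴ := by
      conv_rhs => rw [← hVJ i, conjTranspose_mul]
      rw [← star_eq_conjTranspose (V i), (hV i).isSelfAdjoint.star_eq]
    refine ⟨J i * X * (J i)ᴴ, ?_⟩
    calc _ = (V i * J i) * X * ((J i)ᴴ * V i) := by rw [hVJ, h1]
      _ = _ := by simp only [Matrix.mul_assoc]
  have hzero : ∀ i j, i ≠ j → ∀ Z ∈ corner (W j), L' i * Z = 0 := by
    rintro i j hij Z ⟨Y, rfl⟩
    rw [← hLW j]
    calc _ = (L' i * L j) * (L' j * W j * Y * (L j * L' j * W j)) := by simp only [Matrix.mul_assoc]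
      _ = _ := by rw [hL.mul_of_ne i j hij, Matrix.zero_mul]
  have hfix : ∀ i, ∀ Z ∈ corner (W i), L i * (L' i * Z * (L' i)ᴴ) * (L i)ᴴ = Z := by
    rintro i Z ⟨Y, rfl⟩
    have h1 : W i * ((L' i)ᴴ * (L i)ᴴ) = W i := by
      have := congrArg conjTranspose (hLW i)
      rwa [conjTranspose_mul, conjTranspose_mul, ← star_eq_conjTranspose (W i),
        (hW i).isSelfAdjoint.star_eq] at this
    calc _ = (L i * L' i * W i) * Y * (W i * ((L' i)ᴴ * (L i)ᴴ)) := by simp only [Matrix.mul_assoc]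
      _ = _ := by rw [h1, hLW]
  set R := fun i => MatrixMap.conj (J i) (L' i) T with hR
  have hTR : ∀ i X, T (J i * X * (J i)ᴴ) = L i * R i X * (L i)ᴴ := fun i X =>
    (hfix i _ (hVW i (hmemJ i X))).symm
  have hRpos : ∀ i, IsPositive (R i) := fun i => hT.conj _ _
  have hwpos : ∀ i, 0 < (W i).rank := fun i =>
    Nat.pos_of_mul_pos_right (hratio i ▸ Nat.mul_pos hm (hpos i))
  have hR1 : ∀ i, (R i 1).PosDef := by
    intro i
    have h1 := hJ.posDef_sum (A := fun _ => 1) fun _ => PosDef.one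
    have h2 := hT.posDef hT1 h1
    -- `L' i` annihilates the images of the other blocks, so `R i 1` is a compression of a positive
    -- definite matrix.
    have h3 : R i 1 = L' i * T (∑ j, J j * (1 : Matrix (Fin (V j).rank) (Fin (V j).rank) ℂ) * (J j)ᴴ)
        * (L' i)ᴴ := by
      rw [map_sum, Matrix.mul_sum, Finset.sum_eq_single i]
      · rfl
      · exact fun j _ hj => hzero i j hj.symm _ (hVW j (hmemJ j 1))
      · simp
    rw [h3]
    refine h2.mul_mul_conjTranspose_same ?_
    intro x y hxy
    have := congrArg (fun z => z ᵥ* L i) hxy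
    simpa [vecMul_vecMul, hL.mul_self] using this
  choose X hX using fun i => exists_isScalingPoint (hpos i) (hwpos i) (hRpos i) (hR1 i)
    (fun X hX h1 h2 => by
      have h := hrank i (J i * X * (J i)ᴴ) (hmemJ i X) (hX.mul_mul_conjTranspose_same _)
      rw [hTR, rank_mul_mul_conjTranspose (hJ.mul_self i),
        rank_mul_mul_conjTranspose (hL.mul_self i)] at h
      exact h h1 h2)
  have hTX : T (∑ i, J i * X i * (J i)ᴴ) = ∑ i, L i * R i (X i) * (L i)ᴴ := by
    rw [map_sum]
    exact Finset.sum_congr rfl fun i _ => hTR i (X i)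
  refine ⟨∑ i, J i * X i * (J i)ᴴ, hJ.posDef_sum fun i => (hX i).posDef, ?_, fun H => ?_⟩
  · rw [hTX]
    exact hL.posDef_sum fun i => (hX i).map_posDef
  rw [hTX, hL.inv_sum fun i => (hX i).map_posDef, hJ.inv_sum fun i => (hX i).posDef,
    Finset.sum_mul, Finset.sum_mul, trace_sum, trace_sum, Finset.mul_sum, Finset.mul_sum]
  refine Finset.sum_congr rfl fun i _ => ?_
  have hZpos := (hX i).map_posDef.inv.posSemidef
  set H' := J' i * H * (J' i)ᴴ with hH'
  have key := hT.trace_conjTranspose_mul_mul_mul hJ (L' i) hZpos (fun j hj => by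
    simpa using hzero i j hj.symm _ (hVW j (hmemJ j 1))) H
  have key2 : ((J' i)ᴴ * (X i)⁻¹ * J' i * H).trace = ((X i)⁻¹ * H').trace := by
    rw [Matrix.mul_assoc, Matrix.mul_assoc, trace_mul_comm, hH']
    simp only [Matrix.mul_assoc]
  rw [key, key2]
  have h := (hX i).trace_eq H'
  have hr : ((W i).rank : ℂ) * k = m * (V i).rank := by exact_mod_cast hratio i
  have hv : ((V i).rank : ℂ) ≠ 0 := by exact_mod_cast (hpos i).ne'
  refine mul_left_cancel₀ hv ?_
  linear_combination (k : ℂ) * h + ((X i)⁻¹ * H').trace * hr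

end MatrixMap

/-! ### Projections, idempotents and their images -/

namespace Matrix

theorem posSemidef_of_isStarProjection {n : Type*} [Fintype n] {P : Matrix n n ℂ}
    (hP : IsStarProjection P) : P.PosSemidef := by
  have h := posSemidef_conjTranspose_mul_self P
  rwa [← star_eq_conjTranspose, hP.isSelfAdjoint.star_eq, hP.isIdempotentElem.eq] at h

theorem trace_eq_rank_of_isIdempotentElem {n : Type*} [Fintype n] [DecidableEq n]
    {P : Matrix n n ℂ} (hP : IsIdempotentElem P) : P.trace = P.rank := by
  have h : IsIdempotentElem (toLin' P) := by
    rw [IsIdempotentElem, Module.End.mul_eq_comp, ← toLin'_mul, hP.eq]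
  have h2 := (LinearMap.IsIdempotentElem.isProj_range _ h).trace
  rw [trace_toLin'_eq] at h2
  exact h2

section

variable {n : Type*} [Fintype n] {A B P : Matrix n n ℂ}

theorem mul_eq_of_isStarProjection (hA : A.IsHermitian) (hP : IsStarProjection P)
    (h : A * P = A) : P * A = A := by
  have := congrArg conjTranspose h
  rwa [conjTranspose_mul, hA.eq, ← star_eq_conjTranspose, hP.isSelfAdjoint.star_eq] at this

theorem mul_eq_of_isStarProjection' (hA : A.IsHermitian) (hP : IsStarProjection P)
    (h : P * A = A) : A * P = A := by
  have := congrArg conjTranspose h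
  rwa [conjTranspose_mul, hA.eq, ← star_eq_conjTranspose, hP.isSelfAdjoint.star_eq] at this

/-- `P` is the support of `M Mᴴ`; `P M = M` because `(P M - M)(P M - M)ᴴ = 0`. -/
theorem exists_isStarProjection_range [DecidableEq n] (M : Matrix n n ℂ) :
    ∃ P N : Matrix n n ℂ, IsStarProjection P ∧ P * M = M ∧ P = M * N := by
  obtain ⟨P, B, hP, -, hPB, hPM, -⟩ := (posSemidef_self_mul_conjTranspose M).exists_support
  refine ⟨P, Mᴴ * B, hP, ?_, by rw [hPB, Matrix.mul_assoc]⟩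
  have h : (P * M - M) * (P * M - M)ᴴ = 0 := by
    rw [conjTranspose_sub, conjTranspose_mul, Matrix.sub_mul, Matrix.mul_sub, Matrix.mul_sub,
      ← Matrix.mul_assoc (P * M), Matrix.mul_assoc P M, hPM, ← Matrix.mul_assoc M]
    abel
  exact sub_eq_zero.1 (self_mul_conjTranspose_eq_zero.1 h)

theorem rank_pos_of_ne_zero (hA : A ≠ 0) : 0 < A.rank := by
  classical
  rw [Nat.pos_iff_ne_zero]
  intro h
  refine hA (toLin'.injective ?_)
  rw [map_zero]
  have h1 : LinearMap.range A.mulVecLin = ⊥ := Submodule.finrank_eq_zero.1 h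
  rw [LinearMap.range_eq_bot] at h1
  exact h1

end

theorem isInternal_image {k s : ℕ} {E : Fin s → Matrix (Fin k) (Fin k) ℂ}
    (hE : ∀ i, IsIdempotentElem (E i)) (ho : ∀ i j, i ≠ j → E i * E j = 0) (hs : ∑ i, E i = 1) :
    DirectSum.IsInternal (fun i => MatrixMap.image (E i)) := by
  refine DirectSum.isInternal_submodule_of_iSupIndep_of_iSup_eq_top ?_ ?_
  · intro i
    rw [Submodule.disjoint_def]
    rintro _ ⟨x, rfl⟩ hx
    have hle : ⨆ j, ⨆ _ : j ≠ i, MatrixMap.image (E j) ≤ LinearMap.ker (E i).mulVecLin := by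
      refine iSup₂_le fun j hj => ?_
      rintro _ ⟨y, rfl⟩
      rw [LinearMap.mem_ker, mulVecLin_apply, mulVecLin_apply, mulVec_mulVec, ho i j hj.symm,
        zero_mulVec]
    have h := hle hx
    rwa [LinearMap.mem_ker, mulVecLin_apply, mulVecLin_apply, mulVec_mulVec, (hE i).eq] at h
  · rw [eq_top_iff]
    intro x _
    have h : x = ∑ i, E i *ᵥ x := by rw [← Matrix.sum_mulVec, hs, one_mulVec]
    rw [h]
    exact Submodule.sum_mem _ fun i _ => Submodule.mem_iSup_of_mem i ⟨x, rfl⟩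

end Matrix

/-! ### Tight projections and minimal decompositions -/

namespace MatrixMap

variable {k m : ℕ} {R : Matrix (Fin k) (Fin k) ℂ →ₗ[ℂ] Matrix (Fin m) (Fin m) ℂ}

theorem mem_corner_iff {P : Matrix (Fin k) (Fin k) ℂ} (hP : IsIdempotentElem P)
    {Z : Matrix (Fin k) (Fin k) ℂ} : Z ∈ corner P ↔ P * Z = Z ∧ Z * P = Z := by
  constructor
  · rintro ⟨X, rfl⟩
    constructor
    · rw [← Matrix.mul_assoc, ← Matrix.mul_assoc, hP.eq]
    · rw [Matrix.mul_assoc, hP.eq]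
  · rintro ⟨h1, h2⟩
    exact ⟨Z, by rw [h1, h2]⟩

/-- The orthogonal projections that a unital map sends to orthogonal projections. -/
def IsTight (R : Matrix (Fin k) (Fin k) ℂ →ₗ[ℂ] Matrix (Fin m) (Fin m) ℂ)
    (P : Matrix (Fin k) (Fin k) ℂ) : Prop :=
  IsStarProjection P ∧ IsStarProjection (R P)

/-- For semidefinite `X`, `P X P ≤ C P` gives `R(P X P) ≤ C R(P)`, so `R(P X P)` vanishes on the
kernel of the projection `R(P)`. Linearity extends this to all `X`. -/
theorem IsTight.mapsTo_corner (hR : IsPositive R) {P : Matrix (Fin k) (Fin k) ℂ}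
    (hP : IsTight R P) : Set.MapsTo R (corner P) (corner (R P)) := by
  obtain ⟨hP1, hP2⟩ := hP
  have hPH : Pᴴ = P := hP1.isSelfAdjoint
  set f : Matrix (Fin k) (Fin k) ℂ →ₗ[ℂ] Matrix (Fin m) (Fin m) ℂ :=
    R ∘ₗ LinearMap.mulRight ℂ P ∘ₗ LinearMap.mulLeft ℂ P
  set g := LinearMap.mulRight ℂ (R P) ∘ₗ LinearMap.mulLeft ℂ (R P) ∘ₗ f
  have hfg : g = f := by
    refine linearMap_eq_of_posSemidef fun X hX => ?_
    have hPX : (P * X * P).PosSemidef := by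
      have := hX.mul_mul_conjTranspose_same P
      rwa [hPH] at this
    obtain ⟨C, -, hC⟩ := hX.1.exists_smul_one_sub
    have h1 := hC.mul_mul_conjTranspose_same P
    rw [hPH, Matrix.mul_sub, Matrix.sub_mul, Matrix.mul_smul, Matrix.smul_mul, Matrix.mul_one,
      hP1.isIdempotentElem.eq] at h1
    have h2 := hR.smul_sub h1
    have hRX := hR _ hPX
    have h3 : R (P * X * P) * (1 - R P) = 0 := by
      refine toLin'.injective (LinearMap.ext fun x => ?_)
      rw [toLin'_apply, ← mulVec_mulVec, map_zero, LinearMap.zero_apply]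
      refine hRX.mulVec_eq_zero_of_smul_sub h2 ?_
      rw [mulVec_mulVec, hP2.mul_one_sub_self, zero_mulVec]
    rw [Matrix.mul_sub, Matrix.mul_one, sub_eq_zero] at h3
    change R P * R (P * X * P) * R P = R (P * X * P)
    rw [mul_eq_of_isStarProjection hRX.1 hP2 h3.symm, ← h3]
  rintro _ ⟨X, rfl⟩
  exact ⟨f X, (LinearMap.congr_fun hfg X).symm⟩

theorem IsTight.one_sub (hR1 : R 1 = 1) {P : Matrix (Fin k) (Fin k) ℂ} (hP : IsTight R P) :
    IsTight R (1 - P) := by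
  refine ⟨hP.1.one_sub, ?_⟩
  rw [map_sub, hR1]
  exact hP.2.one_sub

theorem IsTight.sub (hR : IsPositive R) {P P' : Matrix (Fin k) (Fin k) ℂ} (hP : IsTight R P)
    (hP' : IsTight R P') (h : P * P' = P') : IsTight R (P - P') := by
  refine ⟨hP'.1.sub_of_mul_eq_right hP.1 h, ?_⟩
  rw [map_sub]
  have h1 := hP.mapsTo_corner hR ((mem_corner_iff hP.1.isIdempotentElem).2
    ⟨h, mul_eq_of_isStarProjection' hP'.1.isSelfAdjoint hP.1 h⟩)
  exact hP'.2.sub_of_mul_eq_right hP.2 ((mem_corner_iff hP.2.isIdempotentElem).1 h1).1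

theorem IsTight.map_mul_eq_zero (hR : IsPositive R) (hR1 : R 1 = 1)
    {P Q : Matrix (Fin k) (Fin k) ℂ} (hP : IsTight R P) (hQ : IsTight R Q) (h : P * Q = 0) :
    R P * R Q = 0 := by
  have h1 : (1 - P) * Q = Q := by rw [Matrix.sub_mul, h, Matrix.one_mul, sub_zero]
  have hP' := hP.one_sub hR1
  have h2 := hP'.mapsTo_corner hR ((mem_corner_iff hP'.1.isIdempotentElem).2
    ⟨h1, mul_eq_of_isStarProjection' hQ.1.isSelfAdjoint hP'.1 h1⟩)
  have h3 := ((mem_corner_iff hP'.2.isIdempotentElem).1 h2).1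
  rw [map_sub, hR1, Matrix.sub_mul, Matrix.one_mul] at h3
  simpa using h3

/-- `R(P) ≤ 1` bounds `tr R(P) = (m/k) rank P` by `rank R(P)`, and equality makes `R(P)` a
projection. -/
theorem rank_mul_le_rank_map (hk : 0 < k) (hR : IsPositive R) (hR1 : R 1 = 1)
    (htr : ∀ Z, (R Z).trace = ((m / k : ℝ) : ℂ) * Z.trace) {P : Matrix (Fin k) (Fin k) ℂ}
    (hP : IsStarProjection P) :
    P.rank * m ≤ (R P).rank * k ∧ (P.rank * m = (R P).rank * k → IsTight R P) := by
  have h1 : (1 - R P).PosSemidef := by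
    have := hR _ (posSemidef_of_isStarProjection hP.one_sub)
    rwa [map_sub, hR1] at this
  obtain ⟨h2, h3⟩ := (hR _ (posSemidef_of_isStarProjection hP)).trace_re_le_rank h1
  have h4 := htr P
  rw [trace_eq_rank_of_isIdempotentElem hP.isIdempotentElem, ← Complex.ofReal_natCast,
    ← Complex.ofReal_mul] at h4
  have hkR : (0 : ℝ) < k := by exact_mod_cast hk
  constructor
  · rw [h4, Complex.ofReal_re, div_mul_eq_mul_div, div_le_iff₀ hkR] at h2
    have : m * P.rank ≤ (R P).rank * k := by exact_mod_cast h2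
    linarith
  · intro h
    refine ⟨hP, h3 ?_⟩
    rw [h4, ← Complex.ofReal_natCast]
    congr 1
    rw [div_mul_eq_mul_div, div_eq_iff hkR.ne']
    have : (P.rank : ℝ) * m = (R P).rank * k := by exact_mod_cast h
    linarith

theorem IsTight.rank_map (hk : 0 < k) (htr : ∀ Z, (R Z).trace = ((m / k : ℝ) : ℂ) * Z.trace)
    {P : Matrix (Fin k) (Fin k) ℂ} (hP : IsTight R P) : (R P).rank * k = m * P.rank := by
  have h4 := htr P
  rw [trace_eq_rank_of_isIdempotentElem hP.1.isIdempotentElem,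
    trace_eq_rank_of_isIdempotentElem hP.2.isIdempotentElem, ← Complex.ofReal_natCast,
    ← Complex.ofReal_natCast, ← Complex.ofReal_mul, Complex.ofReal_inj] at h4
  have hkR : (0 : ℝ) < k := by exact_mod_cast hk
  rw [div_mul_eq_mul_div, eq_div_iff hkR.ne'] at h4
  exact_mod_cast h4

/-- Strong induction on the rank: a nonminimal `P` splits into tight `Q` and `P - Q`, both of
smaller rank. -/
theorem exists_minimal_decomposition (hR : IsPositive R) (n : ℕ) :
    ∀ P : Matrix (Fin k) (Fin k) ℂ, IsTight R P → P.rank = n →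
      ∃ (ι : Type) (_ : Fintype ι) (V : ι → Matrix (Fin k) (Fin k) ℂ),
        (∀ i, IsTight R (V i)) ∧ (∀ i, V i ≠ 0) ∧ (∀ i j, i ≠ j → V i * V j = 0) ∧
        ∑ i, V i = P ∧ ∀ i Q, IsTight R Q → V i * Q = Q → Q = 0 ∨ Q = V i := by
  induction n using Nat.strong_induction_on with
  | _ n ih =>
  intro P hP hn
  by_cases hP0 : P = 0
  · exact ⟨Empty, inferInstance, fun i => i.elim, fun i => i.elim, fun i => i.elim,
      fun i => i.elim, by simp [hP0], fun i => i.elim⟩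
  by_cases hmin : ∀ Q, IsTight R Q → P * Q = Q → Q = 0 ∨ Q = P
  · exact ⟨Unit, inferInstance, fun _ => P, fun _ => hP, fun _ => hP0,
      fun i j hij => (hij rfl).elim, by simp, fun _ => hmin⟩
  push Not at hmin
  obtain ⟨Q, hQ, hPQ, hQ0, hQP⟩ := hmin
  have hS := hP.sub hR hQ hPQ
  have hrk : P.rank = Q.rank + (P - Q).rank := by
    have h : P.trace = Q.trace + (P - Q).trace := by rw [trace_sub]; ring
    rw [trace_eq_rank_of_isIdempotentElem hP.1.isIdempotentElem,
      trace_eq_rank_of_isIdempotentElem hQ.1.isIdempotentElem,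
      trace_eq_rank_of_isIdempotentElem hS.1.isIdempotentElem] at h
    exact_mod_cast h
  have h1 := rank_pos_of_ne_zero hQ0
  have h2 := rank_pos_of_ne_zero (sub_ne_zero.2 hQP.symm)
  obtain ⟨ι, _, V, hV1, hV2, hV3, hV4, hV5⟩ := ih Q.rank (by omega) Q hQ rfl
  obtain ⟨κ, _, W, hW1, hW2, hW3, hW4, hW5⟩ := ih (P - Q).rank (by omega) (P - Q) hS rfl
  have hQQ : Q * (P - Q) = 0 := by
    rw [Matrix.mul_sub, hQ.1.isIdempotentElem.eq,
      mul_eq_of_isStarProjection' hQ.1.isSelfAdjoint hP.1 hPQ, sub_self]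
  have hVQ : ∀ i, V i * Q = V i := fun i => by
    rw [← hV4, Finset.mul_sum, Finset.sum_eq_single i (fun j _ hj => hV3 i j hj.symm) (by simp),
      (hV1 i).1.isIdempotentElem.eq]
  have hQW : ∀ i, (P - Q) * W i = W i := fun i => by
    rw [← hW4, Finset.sum_mul, Finset.sum_eq_single i (fun j _ hj => hW3 j i hj) (by simp),
      (hW1 i).1.isIdempotentElem.eq]
  have hVW : ∀ i j, V i * W j = 0 := fun i j => by
    rw [← hVQ, ← hQW, Matrix.mul_assoc, ← Matrix.mul_assoc Q, hQQ, Matrix.zero_mul, Matrix.mul_zero]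
  have hWV : ∀ i j, W j * V i = 0 := fun i j => by
    have h := congrArg star (hVW i j)
    rwa [star_mul, (hV1 i).1.isSelfAdjoint.star_eq, (hW1 j).1.isSelfAdjoint.star_eq, star_zero] at h
  refine ⟨ι ⊕ κ, inferInstance, Sum.elim V W, ?_, ?_, ?_, ?_, ?_⟩
  · rintro (i | i)
    exacts [hV1 i, hW1 i]
  · rintro (i | i)
    exacts [hV2 i, hW2 i]
  · rintro (i | i) (j | j) hij
    · exact hV3 i j (by simpa using hij)
    · exact hVW i j
    · exact hWV j i
    · exact hW3 i j (by simpa using hij)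
  · rw [Fintype.sum_sum_type]
    simp only [Sum.elim_inl, Sum.elim_inr]
    rw [hV4, hW4]
    abel
  · rintro (i | i)
    exacts [hV5 i, hW5 i]

theorem exists_decomposition (hk : 0 < k) (hR : IsPositive R) (hR1 : R 1 = 1)
    (htr : ∀ Z, (R Z).trace = ((m / k : ℝ) : ℂ) * Z.trace) :
    ∃ (s : ℕ) (V : Fin s → Matrix (Fin k) (Fin k) ℂ),
      (∀ i, IsTight R (V i)) ∧ (∀ i, V i ≠ 0) ∧ (∀ i j, i ≠ j → V i * V j = 0) ∧ ∑ i, V i = 1 ∧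
      ∀ i, ∀ X ∈ corner (V i), X.PosSemidef → 0 < X.rank → X.rank < (V i).rank →
        X.rank * (R (V i)).rank < (R X).rank * (V i).rank := by
  have h1 : IsTight R 1 := ⟨.one _, by rw [hR1]; exact .one _⟩
  obtain ⟨ι, _, V, hV1, hV2, hV3, hV4, hV5⟩ := exists_minimal_decomposition hR _ 1 h1 rfl
  let e := (Fintype.equivFin ι).symm
  refine ⟨Fintype.card ι, V ∘ e, fun i => hV1 _, fun i => hV2 _,
    fun i j hij => hV3 _ _ (e.injective.ne hij), by rw [← hV4]; exact e.sum_comp V, ?_⟩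
  intro i X hXc hX hX0 hXlt
  simp only [Function.comp_apply] at *
  -- It suffices to treat the support `P` of `X`: the ranks agree and `P ≤ C X` gives `rank R(P) ≤
  -- rank R(X)`. Equality of ranks would make `P` tight below the minimal `V (e i)`, hence `0` or
  -- all of it.
  obtain ⟨P, B, hP, hPr, hPB, -, C, -, hC⟩ := hX.exists_support
  have hVP : V (e i) * P = P := by
    rw [hPB, ← Matrix.mul_assoc, ((mem_corner_iff (hV1 _).1.isIdempotentElem).1 hXc).1]
  obtain ⟨hle, heq⟩ := rank_mul_le_rank_map hk hR hR1 htr hP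
  have hlt : P.rank * m < (R P).rank * k := by
    refine lt_of_le_of_ne hle fun h => ?_
    rcases hV5 _ P (heq h) hVP with h | h
    · rw [h, rank_zero] at hPr
      omega
    · rw [h] at hPr
      omega
  have hle2 : (R P).rank ≤ (R X).rank :=
    (hR _ (posSemidef_of_isStarProjection hP)).rank_le_of_smul_sub (hR.smul_sub hC)
  have hlt2 : X.rank * m < (R X).rank * k := by
    rw [← hPr]
    exact hlt.trans_le (Nat.mul_le_mul_right _ hle2)
  have hr := (hV1 (e i)).rank_map hk htr
  refine lt_of_mul_lt_mul_right (a := k) ?_ (Nat.zero_le _)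
  calc X.rank * (R (V (e i))).rank * k = X.rank * m * (V (e i)).rank := by
        rw [mul_assoc, hr, mul_assoc]
    _ < (R X).rank * k * (V (e i)).rank := Nat.mul_lt_mul_of_pos_right hlt2 (by omega)
    _ = _ := by ring

end MatrixMap

/-! ### Transporting the decomposition through the equivalence -/

namespace MatrixMap

variable {k m : ℕ} {T S : Matrix (Fin k) (Fin k) ℂ →ₗ[ℂ] Matrix (Fin m) (Fin m) ℂ}

theorem IsPositive.smul (hS : IsPositive S) {c : ℂ} (hc : 0 ≤ c) : IsPositive (c • S) :=
  fun _ hX => (hS _ hX).smul hc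

/-- The orthogonal projections onto the images of `A * V i` for an orthogonal decomposition `V`. -/
theorem exists_transported_projections {s : ℕ} {V : Fin s → Matrix (Fin k) (Fin k) ℂ}
    (hV : ∀ i, IsIdempotentElem (V i)) (ho : ∀ i j, i ≠ j → V i * V j = 0) (hs : ∑ i, V i = 1)
    {A : Matrix (Fin k) (Fin k) ℂ} (hA : IsUnit A) :
    ∃ P N : Fin s → Matrix (Fin k) (Fin k) ℂ, (∀ i, IsStarProjection (P i)) ∧
      (∀ i, P i * (A * V i) = A * V i) ∧ (∀ i, P i = A * V i * N i) ∧
      (∀ i, (P i).rank = (V i).rank) ∧ DirectSum.IsInternal (fun i => image (P i)) := by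
  have hAd := (isUnit_iff_isUnit_det _).1 hA
  choose P N hP hPA hPN using fun i => exists_isStarProjection_range (A * V i)
  refine ⟨P, N, hP, hPA, hPN, fun i => ?_, ?_⟩
  · have h1 : (A * V i).rank = (V i).rank := rank_mul_eq_right_of_isUnit_det _ _ hAd
    rw [← h1]
    refine le_antisymm ?_ ?_
    · rw [hPN]
      exact rank_mul_le_left _ _
    · conv_lhs => rw [← hPA]
      exact rank_mul_le_left _ _
  · have hE : ∀ i j, (A * V i * A⁻¹) * (A * V j * A⁻¹) = A * (V i * V j) * A⁻¹ := by
      intro i j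
      calc _ = A * V i * (A⁻¹ * A) * V j * A⁻¹ := by simp only [Matrix.mul_assoc]
        _ = _ := by rw [nonsing_inv_mul _ hAd]; simp only [Matrix.mul_assoc, Matrix.one_mul]
    -- The similar idempotents `A V i A⁻¹` resolve the identity and have the same images as the
    -- orthogonal projections `P i`.
    have h := isInternal_image (E := fun i => A * V i * A⁻¹)
      (fun i => by rw [IsIdempotentElem, hE, (hV i).eq])
      (fun i j hij => by rw [hE, ho i j hij]; simp)
      (by rw [← Finset.sum_mul, ← Matrix.mul_sum, hs, Matrix.mul_one, mul_nonsing_inv _ hAd])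
    convert! h using 1
    ext1 i
    apply le_antisymm
    · rintro _ ⟨x, rfl⟩
      refine ⟨A *ᵥ (V i *ᵥ (N i *ᵥ x)), ?_⟩
      simp only [mulVecLin_apply, mulVec_mulVec]
      congr 1
      rw [hPN]
      calc _ = A * V i * (A⁻¹ * A) * V i * N i := by simp only [Matrix.mul_assoc]
        _ = A * (V i * V i) * N i := by
          rw [nonsing_inv_mul _ hAd]; simp only [Matrix.mul_assoc, Matrix.one_mul]
        _ = _ := by rw [(hV i).eq]
    · rintro _ ⟨x, rfl⟩
      refine ⟨(A * V i * A⁻¹) *ᵥ x, ?_⟩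
      simp only [mulVecLin_apply, mulVec_mulVec]
      congr 1
      rw [← Matrix.mul_assoc, hPA]

/-- With `R = c⁻¹ S` and `B = Y⁻¹`, `T(A Z Aᴴ) = c B R(Z) Bᴴ`. The minimal blocks `V i` and `R (V
i)` are moved by `A` and `B`, which preserves all ranks but not orthogonality. -/
theorem exists_decomposition_of_equivalent (hk : 0 < k) (hm : 0 < m) (hTS : Equivalent T S)
    (hS : IsDoublyStochastic S) :
    ∃ (s : ℕ) (V : Fin s → Matrix (Fin k) (Fin k) ℂ) (W : Fin s → Matrix (Fin m) (Fin m) ℂ),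
      (∀ i, IsStarProjection (V i)) ∧ (∀ i, IsStarProjection (W i)) ∧
      DirectSum.IsInternal (fun i => image (V i)) ∧
      DirectSum.IsInternal (fun i => image (W i)) ∧
      (∀ i, Set.MapsTo T (corner (V i)) (corner (W i))) ∧
      (∀ i, ∀ X ∈ corner (V i), X.PosSemidef →
        0 < X.rank → X.rank < (V i).rank →
        X.rank * (W i).rank < (T X).rank * (V i).rank) ∧
      (∀ i, 0 < (V i).rank ∧ (W i).rank * k = m * (V i).rank) := by
  obtain ⟨A, Y, hA, hY, hTS⟩ := hTS
  obtain ⟨hSpos, hS1, hStr⟩ := (isDoublyStochastic_iff hk hm).1 hS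
  have hkR : (0 : ℝ) < k := by exact_mod_cast hk
  have hmR : (0 : ℝ) < m := by exact_mod_cast hm
  have hc : 0 < √(k : ℝ) / √m := div_pos (Real.sqrt_pos.2 hkR) (Real.sqrt_pos.2 hmR)
  set c := √(k : ℝ) / √m with hcdef
  have hc0 : (c : ℂ) ≠ 0 := by exact_mod_cast hc.ne'
  set R := (c : ℂ)⁻¹ • S with hRdef
  have hR : IsPositive R := hSpos.smul (inv_nonneg_of_nonneg (by exact_mod_cast hc.le))
  have hR1 : R 1 = 1 := by
    rw [hRdef, LinearMap.smul_apply, hS1, smul_smul, inv_mul_cancel₀ hc0, one_smul]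
  have hRtr : ∀ Z, (R Z).trace = ((m / k : ℝ) : ℂ) * Z.trace := by
    intro Z
    rw [hRdef, LinearMap.smul_apply, trace_smul, hStr, smul_eq_mul, ← mul_assoc,
      ← Complex.ofReal_inv, ← Complex.ofReal_mul]
    congr 2
    rw [hcdef, inv_div, div_mul_div_comm, Real.mul_self_sqrt hkR.le, Real.mul_self_sqrt hmR.le]
  have hSR : ∀ Z, S Z = (c : ℂ) • R Z := fun Z => by
    rw [hRdef, LinearMap.smul_apply, smul_smul, mul_inv_cancel₀ hc0, one_smul]
  obtain ⟨s, V, hVt, hV0, hVo, hVs, hVr⟩ := exists_decomposition hk hR hR1 hRtr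
  have hAd := (isUnit_iff_isUnit_det _).1 hA
  have hYd := (isUnit_iff_isUnit_det _).1 hY
  have hYHd : IsUnit Yᴴ.det := by rw [det_conjTranspose]; exact hYd.star
  have hAHd : IsUnit Aᴴ.det := by rw [det_conjTranspose]; exact hAd.star
  set B := Y⁻¹ with hB
  have hBu : IsUnit B := by
    rw [isUnit_iff_isUnit_det]
    exact isUnit_nonsing_inv_det _ hYd
  have hTB : ∀ Z, T (A * Z * Aᴴ) = B * ((c : ℂ) • R Z) * Bᴴ := by
    intro Z
    rw [← hSR, hTS, hB, conjTranspose_nonsing_inv]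
    calc _ = 1 * T (A * Z * Aᴴ) * 1 := by rw [Matrix.one_mul, Matrix.mul_one]
      _ = (Y⁻¹ * Y) * T (A * Z * Aᴴ) * (Yᴴ * (Yᴴ)⁻¹) := by
        rw [nonsing_inv_mul _ hYd, mul_nonsing_inv _ hYHd]
      _ = _ := by simp only [Matrix.mul_assoc]
  obtain ⟨P, N, hP, hPA, hPN, hPr, hPi⟩ :=
    exists_transported_projections (fun i => (hVt i).1.isIdempotentElem) hVo hVs hA
  obtain ⟨Q, -, hQ, hQB, -, hQr, hQi⟩ :=
    exists_transported_projections (V := fun i => R (V i)) (fun i => (hVt i).2.isIdempotentElem)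
      (fun i j hij => (hVt i).map_mul_eq_zero hR hR1 (hVt j) (hVo i j hij))
      (by rw [← map_sum, hVs, hR1]) hBu
  -- From `P i = A V i N i` and its adjoint, the corner of `P i` is reached by conjugating the
  -- corner of `V i` with `A`.
  have hfactor : ∀ i, ∀ Z ∈ corner (P i), ∃ X ∈ corner (V i), Z = A * X * Aᴴ := by
    rintro i _ ⟨X, rfl⟩
    refine ⟨V i * (N i * X * (N i)ᴴ) * V i, ⟨_, rfl⟩, ?_⟩
    have h1 : P i = (N i)ᴴ * (V i * Aᴴ) := by
      have := congrArg conjTranspose (hPN i)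
      rwa [conjTranspose_mul, conjTranspose_mul, ← star_eq_conjTranspose (P i),
        (hP i).isSelfAdjoint.star_eq, ← star_eq_conjTranspose (V i),
        (hVt i).1.isSelfAdjoint.star_eq] at this
    calc P i * X * P i = (A * V i * N i) * X * ((N i)ᴴ * (V i * Aᴴ)) := by rw [← h1, ← hPN]
      _ = _ := by simp only [Matrix.mul_assoc]
  refine ⟨s, P, Q, hP, hQ, hPi, hQi, fun i => ?_, fun i => ?_, fun i => ⟨?_, ?_⟩⟩
  · intro Z hZ
    obtain ⟨X, hX, rfl⟩ := hfactor i Z hZ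
    obtain ⟨K, hK⟩ := (hVt i).mapsTo_corner hR hX
    have h1 : (R (V i) * Bᴴ) * Q i = R (V i) * Bᴴ := by
      have := congrArg conjTranspose (hQB i)
      rwa [conjTranspose_mul, conjTranspose_mul, ← star_eq_conjTranspose (Q i),
        (hQ i).isSelfAdjoint.star_eq, ← star_eq_conjTranspose (R (V i)),
        (hVt i).2.isSelfAdjoint.star_eq] at this
    refine ⟨T (A * X * Aᴴ), ?_⟩
    have h2 : T (A * X * Aᴴ) = (B * R (V i)) * ((c : ℂ) • K) * (R (V i) * Bᴴ) := by
      rw [hTB, hK]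
      simp only [Matrix.mul_assoc, Matrix.smul_mul, Matrix.mul_smul]
    rw [h2]
    calc _ = (Q i * (B * R (V i))) * ((c : ℂ) • K) * ((R (V i) * Bᴴ) * Q i) := by rw [h1, hQB]
      _ = _ := by simp only [Matrix.mul_assoc]
  · intro Z hZ hZpos h0 hlt
    obtain ⟨X, hX, rfl⟩ := hfactor i Z hZ
    have hXpos : X.PosSemidef := by
      rwa [← star_eq_conjTranspose, hA.posSemidef_star_right_conjugate_iff] at hZpos
    have hrA : (A * X * Aᴴ).rank = X.rank := rank_mul_mul_conjTranspose (nonsing_inv_mul _ hAd) X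
    have hrT : (T (A * X * Aᴴ)).rank = (R X).rank := by
      rw [hTB, rank_mul_mul_conjTranspose
        (nonsing_inv_mul _ ((isUnit_iff_isUnit_det _).1 hBu))]
      exact rank_smul_of_mem_nonZeroDivisors _ (mem_nonZeroDivisors_of_ne_zero hc0)
    rw [hrA] at h0 hlt ⊢
    rw [hrT, hQr, hPr]
    rw [hPr] at hlt
    exact hVr i X hX hXpos h0 hlt
  · rw [hPr]
    exact rank_pos_of_ne_zero (hV0 i)
  · rw [hPr, hQr]
    exact (hVt i).rank_map hk hRtr

end MatrixMap

/-! ### The equivalence, with the degenerate dimensions -/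

theorem theorem3p6 (k m : ℕ)
    (T : Matrix (Fin k) (Fin k) ℂ →ₗ[ℂ] Matrix (Fin m) (Fin m) ℂ)
    (hT : MatrixMap.IsPositive T)
    (hT1 : (T 1).PosDef) (hT1' : (MatrixMap.adjoint T 1).PosDef) :
    (∃ S : Matrix (Fin k) (Fin k) ℂ →ₗ[ℂ] Matrix (Fin m) (Fin m) ℂ,
        MatrixMap.Equivalent T S ∧ MatrixMap.IsDoublyStochastic S) ↔
      ∃ (s : ℕ) (V : Fin s → Matrix (Fin k) (Fin k) ℂ) (W : Fin s → Matrix (Fin m) (Fin m) ℂ),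
        (∀ i, IsStarProjection (V i)) ∧ (∀ i, IsStarProjection (W i)) ∧
        DirectSum.IsInternal (fun i => MatrixMap.image (V i)) ∧
        DirectSum.IsInternal (fun i => MatrixMap.image (W i)) ∧
        (∀ i, Set.MapsTo T (MatrixMap.corner (V i)) (MatrixMap.corner (W i))) ∧
        (∀ i, ∀ X ∈ MatrixMap.corner (V i), X.PosSemidef →
          0 < X.rank → X.rank < (V i).rank →
          X.rank * (W i).rank < (T X).rank * (V i).rank) ∧
        (∀ i, 0 < (V i).rank ∧ ((W i).rank : ℚ) / ((V i).rank : ℚ) = (m : ℚ) / (k : ℚ)) := by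
  have hratio : ∀ v w : ℕ, 0 < k → 0 < v →
      ((w : ℚ) / v = (m : ℚ) / k ↔ w * k = m * v) := by
    intro v w hk hv
    rw [div_eq_div_iff (by exact_mod_cast hv.ne') (by exact_mod_cast hk.ne')]
    exact_mod_cast Iff.rfl
  -- For `k = 0` the matrix `T 1 = 0` is positive definite only if `m = 0`; then the empty
  -- decomposition works. For `k > 0`, positive definiteness of `T*(1)` similarly forces `m > 0`.
  rcases Nat.eq_zero_or_pos k with rfl | hk
  · have hm : m = 0 := by
      by_contra hm
      have : Nonempty (Fin m) := ⟨⟨0, Nat.pos_of_ne_zero hm⟩⟩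
      have h := hT1.trace_pos
      rw [Subsingleton.elim (1 : Matrix (Fin 0) (Fin 0) ℂ) 0, map_zero, trace_zero] at h
      exact lt_irrefl _ h
    subst hm
    constructor
    · intro _
      exact ⟨0, fun i => i.elim0, fun i => i.elim0, fun i => i.elim0, fun i => i.elim0,
        isInternal_image (fun i => i.elim0) (fun i => i.elim0) (Subsingleton.elim _ _),
        isInternal_image (fun i => i.elim0) (fun i => i.elim0) (Subsingleton.elim _ _),
        fun i => i.elim0, fun i => i.elim0, fun i => i.elim0⟩
    · intro _
      exact ⟨T, ⟨1, 1, isUnit_one, isUnit_one, fun _ => Subsingleton.elim _ _⟩, hT,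
        Subsingleton.elim _ _, Subsingleton.elim _ _⟩
  have hm : 0 < m := by
    rw [Nat.pos_iff_ne_zero]
    rintro rfl
    have : Nonempty (Fin k) := ⟨⟨0, hk⟩⟩
    have h := hT1'.trace_pos
    rw [Subsingleton.elim (1 : Matrix (Fin 0) (Fin 0) ℂ) 0, map_zero, trace_zero] at h
    exact lt_irrefl _ h
  constructor
  · rintro ⟨S, hTS, hS⟩
    obtain ⟨s, V, W, h1, h2, h3, h4, h5, h6, h7⟩ :=
      MatrixMap.exists_decomposition_of_equivalent hk hm hTS hS
    exact ⟨s, V, W, h1, h2, h3, h4, h5, h6,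
      fun i => ⟨(h7 i).1, (hratio _ _ hk (h7 i).1).2 (h7 i).2⟩⟩
  · rintro ⟨s, V, W, h1, h2, h3, h4, h5, h6, h7⟩
    obtain ⟨X, hX⟩ := MatrixMap.exists_isScalingPoint_of_decomposition hm hT hT1 h1 h2 h3 h4 h5 h6
      (fun i => (h7 i).1) (fun i => (hratio _ _ hk (h7 i).1).1 (h7 i).2)
    exact hX.exists_equivalent hk hm hT
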